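/- **Hardy–Littlewood Conjecture (HL).** Let $a,b,c$ be integers with $a>0$, $\gcd(a,b,c)=1$, $a+b$ and $c$ not both even, and $b^2-4ac$ not a square. Let $P(n)$ be the number of primes less than $n$ of the form $ax^2+bx+c$ with $x\in\{0,1,2,\dots\}$. Then $P(n)\sim\delta(a,b,c)\frac{\sqrt n}{\log n}$ as $n\to\infty$, where $$\delta(a,b,c)=\frac{\gcd(2,a+b)}{\sqrt a}\prod_{p\mid a,\ p\mid b,\ p>2}\frac{p}{p-1}\ \prod_{p\nmid a,\ p>2}\left(1-\frac{\left(\frac{b^2-4ac}{p}\right)}{p-1}\right)$$ (products over primes, the infinite product being taken in increasing order of $p$ and convergent in that order); in particular there are infinitely many primes of this form. **Notation.** For a nonzero integer $D$ let $E_D: y^2=x^3+Dx$ and, for a prime $p$ of good reduction (that is, not dividing the discriminant of this equation), $a_p(E_D)=1+p-\#E_D(\mathbb F_p)$. For an integer $r$ let $Q(r,N)$ be the set of primes $p\le N$ of the form $p=r^2+x^2$ with $x\in\mathbb Z$, and let $$a_p(2r)=\lim_{N\to\infty}\frac{\#\{p\in Q(r,N): p \text{ of good reduction},\ a_p(E_D)=2r\}}{\#Q(r,N)}.$$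 Let $\tau$ be the function on positive odd integers with $\tau(1)=1$ and $\tau(n)=\prod_{l\mid n}\tau(l^{v_l(n)})$, where $\tau(l^e)=l^e$ for primes $l\equiv3\pmod 4$ and $\tau(l^e)=l^{e-1}(l-2)$ for primes $l\equiv1\pmod4$. **Theorem.** Assume (HL). Let $$D=\pm2^{\sigma}\,p_1\cdots p_r\,(q_1\cdots q_s)^2\,(l_1\cdots l_t)^3,$$ where the $p_i,q_i,l_i$ are pairwise distinct odd primes ($r,s,t\ge0$), and assume $4\,\|\,D$. For $i\in\{1,7\}$ let $r_i$ (resp. $t_i$) be the number of primes among $p_1,\dots,p_r$ (resp. $l_1,\dots,l_t$) that are $\equiv i\pmod 8$. Let $\alpha\equiv1\pmod4$ be an integer with $(D,\alpha)=1$. Then the densities $a_p(2\alpha)$ and $a_p(-2\alpha)$ exist, and: - if $\frac D4\equiv3\pmod4$, then $$a_p(\pm2\alpha)=\frac14\left(1+\frac{(-1)^{r+t}}{\tau(p_1\cdots p_rl_1\cdots l_t)}\pm\frac{2(-1)^{r_1+r_7+s+t_1+t_7}}{\tau(p_1\cdots p_rq_1\cdots q_sl_1\cdots l_t)}\right);$$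 - if $\frac D4\equiv1\pmod4$, then $$a_p(2\alpha)=a_p(-2\alpha)=\frac14\left(1+\frac{(-1)^{r+t}}{\tau(p_1\cdots p_rl_1\cdots l_t)}\right).$$ -/

import Mathlib

open Filter Topology Asymptotics

noncomputable section

/-! ### The Hardy-Littlewood Conjecture for quadratic polynomials -/

/-- The set of primes of the form `a x² + b x + c` with `x = 0, 1, 2, …`. -/
def quadraticPrimes (a b c : ℤ) : Set ℕ :=
  {p : ℕ | p.Prime ∧ ∃ x : ℕ, (p : ℤ) = a * (x : ℤ) ^ 2 + b * (x : ℤ) + c}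

/-- The number of primes less than `n` of the form `a x² + b x + c`. -/
def quadraticPrimeCount (a b c : ℤ) (n : ℕ) : ℕ :=
  {p : ℕ | p ∈ quadraticPrimes a b c ∧ p < n}.ncard

/-- The product of `1 - (d / p) / (p - 1)`, with `d = b² - 4ac` and the Legendre symbol `(d / p)`,
over the odd primes `p < N` not dividing `a`. -/
def hlPartialProduct (a b c : ℤ) (N : ℕ) : ℝ :=
  ∏ p ∈ (Finset.range N).filter (fun p : ℕ => p.Prime ∧ 2 < p ∧ ¬ (p : ℤ) ∣ a),
    (1 - (jacobiSym (b ^ 2 - 4 * a * c) p : ℝ) / ((p : ℝ) - 1))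

/-- The elementary factor `gcd(2, a + b) / √a * ∏ p / (p - 1)` of the constant, the product being
over the odd primes `p` dividing both `a` and `b`. -/
def hlFiniteFactor (a b : ℤ) : ℝ :=
  (Int.gcd 2 (a + b) : ℝ) / Real.sqrt (a : ℝ) *
    ∏ p ∈ a.natAbs.primeFactors.filter (fun p : ℕ => 2 < p ∧ (p : ℤ) ∣ b),
      (p : ℝ) / ((p : ℝ) - 1)

/-- The Hardy-Littlewood Conjecture: with `δ = hlFiniteFactor a b * L`, where `L` is the value of
the (conditionally convergent) infinite product, the number of primes below `n` of the form
`a x² + b x + c` is asymptotic to `δ √n / log n`; in particular there are infinitely many. -/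
def HardyLittlewoodConjecture : Prop :=
  ∀ a b c : ℤ, 0 < a → Int.gcd a (Int.gcd b c) = 1 → ¬ (Even (a + b) ∧ Even c) →
    ¬ IsSquare (b ^ 2 - 4 * a * c) →
    ∃ L : ℝ, Tendsto (hlPartialProduct a b c) atTop (𝓝 L) ∧
      (fun n : ℕ => (quadraticPrimeCount a b c n : ℝ)) ~[atTop]
        (fun n : ℕ => hlFiniteFactor a b * L * (Real.sqrt (n : ℝ) / Real.log (n : ℝ))) ∧
      (quadraticPrimes a b c).Infinite

/-! ### The curve `y² = x³ + D x` and its traces of Frobenius -/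

/-- The Weierstrass equation `y² = x³ + D x`. -/
def curveE (D : ℤ) : WeierstrassCurve ℤ := ⟨0, 0, 0, D, 0⟩

/-- `a_p = 1 + p - #E_D(𝔽_p)`, where `E_D(𝔽_p)` includes the point at infinity. -/
def frobeniusTrace (D : ℤ) (p : ℕ) : ℤ :=
  1 + (p : ℤ) -
    (Nat.card ((curveE D).map (Int.castRingHom (ZMod p))).toAffine.Point : ℤ)

/-- `Q(r, N)`: the primes `p ≤ N` of the form `r² + x²`. -/
def primesSqAdd (r : ℤ) (N : ℕ) : Set ℕ :=
  {p : ℕ | p.Prime ∧ p ≤ N ∧ ∃ x : ℤ, (p : ℤ) = r ^ 2 + x ^ 2}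

/-- The density `a_p(E_D, 2r)` exists and equals `δ`: among the primes of the form `r² + x²`, the
proportion of those (of good reduction) with `a_p = 2r` tends to `δ`. -/
def HasTraceDensity (D r : ℤ) (δ : ℝ) : Prop :=
  Tendsto
    (fun N : ℕ =>
      ({p : ℕ | p ∈ primesSqAdd r N ∧ ¬ (p : ℤ) ∣ (curveE D).Δ ∧
          frobeniusTrace D p = 2 * r}.ncard : ℝ) / ((primesSqAdd r N).ncard : ℝ))
    atTop (𝓝 δ)

/-! ### The arithmetic function `τ` and counting primes modulo 8 -/

/-- `τ(l ^ e)` for a prime `l` and `e ≥ 1`. -/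
def tauPrimePow (l e : ℕ) : ℕ :=
  if l % 4 = 1 then l ^ (e - 1) * (l - 2) else l ^ e

/-- The multiplicative extension of `τ`, with `τ(1) = 1`. -/
def tau (n : ℕ) : ℕ := n.factorization.prod tauPrimePow

/-- The number of `l ∈ S` with `l ≡ i (mod 8)`. -/
def countMod8 (S : Finset ℕ) (i : ℕ) : ℕ := (S.filter (fun l => l ≡ i [MOD 8])).card

end

/-!
Let `p = α² + x²` be a prime with `α ≡ 1 (mod 4)` and `x` even. Some multiplicative character `χ` of
order four modulo `p`, with values in `ℤ[i]`, has the Jacobi sum `J(χ, χ²) = -χ(-1) (α + x i)`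
(`exists_quarticChar`): the sum has norm `p`, is congruent to `-p` modulo `2 (1 - i)`, and `p` is a
sum of two squares in only one way. Counting points on `y² = x³ + D x` with `χ` shows that the trace
of Frobenius is twice the real part of `χ(D)³ (α + x i)`; so it is `2 α` (resp. `-2 α`) exactly when
`χ(D)` is `1` (resp. `-1`) (`frobeniusTrace_eq_iff`).

The value `χ(D)` depends only on `x` modulo `4` and modulo the odd primes `l` dividing `D`. For such
an `l`, the Frobenius action on a quartic Gauss sum in characteristic `l` gives
`χ(±l) = ((α + x i) / (α - x i)) ^ m` with `m = (l ∓ 1) / 4`, the sign being chosen such that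
`±l ≡ 1 (mod 4)` (`quartic_reciprocity`). As `x` varies each fourth root of unity is attained `m`
times, except that `(-1) ^ m` is attained `m - 1` times: the equation for a given value is
polynomial of degree at most `m`, or `m - 1` for the exceptional value, which the quotient takes at
infinity, and the total number of admissible `x` is `4 m - 1 = τ(l)` (`exists_quarticSymbol`). The
factor `± 4` of `D` contributes `1` if `D / 4 ≡ 3 (mod 4)` and `(-1) ^ (x / 2)` if
`D / 4 ≡ 1 (mod 4)`; in the second case it makes the odd power sums vanish.

The Hardy-Littlewood Conjecture, applied to `(x₀ + M k)² + α²` as a polynomial in `k`, gives all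
classes `x₀` modulo `M` with `α² + x₀²` coprime to `M` the same asymptotics, with a nonzero constant
(`exists_tendsto_classPrimes`). A density is therefore a proportion of classes
(`tendsto_density`). The proportion of classes with `χ(D) = ±1` follows by orthogonality on the
fourth roots of unity, the power sums being products of local ones by the Chinese remainder theorem
(`sum_range_prod_of_periodic`).
-/

/-! ### Fourth roots of unity in the Gaussian integers -/

lemma GaussianInt.eq_of_pow_four_eq_one {z : GaussianInt} (hz : z ^ 4 = 1) :
    z = 1 ∨ z = -1 ∨ z = ⟨0, 1⟩ ∨ z = ⟨0, -1⟩ := by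
  have hI : (⟨0, 1⟩ : GaussianInt) ^ 2 = -1 := by decide
  have hI' : (⟨0, -1⟩ : GaussianInt) = -⟨0, 1⟩ := by decide
  have h : (z - 1) * ((z + 1) * ((z - ⟨0, 1⟩) * (z - ⟨0, -1⟩))) = 0 := by
    rw [hI']
    linear_combination hz - (z ^ 2 - 1) * hI
  simpa [sub_eq_zero, add_eq_zero_iff_eq_neg] using h

lemma GaussianInt.mul_star_of_pow_four_eq_one {z : GaussianInt} (hz : z ^ 4 = 1) :
    z * star z = 1 := by
  rcases GaussianInt.eq_of_pow_four_eq_one hz with rfl | rfl | rfl | rfl <;> decide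

lemma GaussianInt.isPrimitiveRoot_I : IsPrimitiveRoot (⟨0, 1⟩ : GaussianInt) 4 := by
  rw [IsPrimitiveRoot.iff (by norm_num)]
  refine ⟨by decide, fun l h0 h4 => ?_⟩
  interval_cases l <;> decide

/-! ### Quartic characters modulo `p` -/

section QuarticChar

variable {p : ℕ} [Fact p.Prime] {χ : MulChar (ZMod p) GaussianInt}

lemma quartic_pow_four (hχ : orderOf χ = 4) {a : ZMod p} (ha : a ≠ 0) : χ a ^ 4 = 1 := by
  rw [← MulChar.pow_apply' χ (by norm_num), ← hχ, pow_orderOf_eq_one,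
    MulChar.one_apply ha.isUnit]

lemma quartic_mod_four (hχ : orderOf χ = 4) : p % 4 = 1 := by
  have h := MulChar.orderOf_dvd_card_sub_one (χ := χ)
  rw [hχ, ZMod.card] at h
  have := (Fact.out : p.Prime).two_le
  omega

lemma quartic_inv (hχ : orderOf χ = 4) : χ⁻¹ = χ.ringHomComp (starRingEnd GaussianInt) := by
  refine (inv_eq_of_mul_eq_one_right ?_)
  ext1 a
  rw [MulChar.mul_apply, MulChar.ringHomComp_apply, starRingEnd_apply,
    GaussianInt.mul_star_of_pow_four_eq_one (quartic_pow_four hχ a.ne_zero), MulChar.one_apply_coe]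

/-- The square of a quartic character is the quadratic character. -/
lemma quartic_sq (hχ : orderOf χ = 4) :
    χ ^ 2 = (quadraticChar (ZMod p)).ringHomComp (Int.castRingHom GaussianInt) := by
  have hp := quartic_mod_four hχ
  have h2 : ringChar (ZMod p) ≠ 2 := by rw [ZMod.ringChar_zmod_n]; omega
  obtain ⟨g, hg⟩ := IsCyclic.exists_generator (α := (ZMod p)ˣ)
  rw [MulChar.eq_iff hg]
  have hq : quadraticChar (ZMod p) g = -1 := by
    rcases quadraticChar_dichotomy g.ne_zero with h | h
    · refine absurd ((MulChar.eq_iff hg (quadraticChar (ZMod p)) 1).2 ?_) (quadraticChar_ne_one h2)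
      rw [h, MulChar.one_apply_coe]
    · exact h
  have h4 : (χ g ^ 2 - 1) * (χ g ^ 2 + 1) = 0 := by
    linear_combination quartic_pow_four hχ g.ne_zero
  have h1 : χ g ^ 2 ≠ 1 := by
    intro h
    have : χ ^ 2 = 1 := by
      rw [MulChar.eq_iff hg, MulChar.pow_apply_coe, h, MulChar.one_apply_coe]
    have := orderOf_dvd_of_pow_eq_one this
    rw [hχ] at this
    omega
  rw [MulChar.pow_apply_coe, MulChar.ringHomComp_apply, hq]
  rcases mul_eq_zero.1 h4 with h | h
  · exact absurd (sub_eq_zero.1 h) h1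
  · rw [eq_neg_of_add_eq_zero_left h]; simp

lemma quartic_sq_apply (hχ : orderOf χ = 4) (a : ZMod p) :
    χ a ^ 2 = (quadraticChar (ZMod p) a : GaussianInt) := by
  rw [← MulChar.pow_apply' χ (by norm_num), quartic_sq hχ, MulChar.ringHomComp_apply]
  simp

/-- With `j ^ 2 = -1`, both `χ (-1) = χ j ^ 2` and `χ 4 = χ 2 ^ 2` are quadratic symbols, and
`(1 + j) ^ 2 = 2 * j` identifies them. -/
lemma quartic_neg_one (hχ : orderOf χ = 4) :
    χ (-1) = (quadraticChar (ZMod p) 2 : GaussianInt) := by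
  have hp := quartic_mod_four hχ
  obtain ⟨j, hj⟩ := ZMod.exists_sq_eq_neg_one_iff.2 (show p % 4 ≠ 3 by omega)
  have h2 : (2 : ZMod p) ≠ 0 := by
    have : ((2 : ℕ) : ZMod p) ≠ 0 := by
      rw [Ne, ZMod.natCast_eq_zero_iff]
      intro h
      have := Nat.le_of_dvd (by norm_num) h
      have := (Fact.out : p.Prime).two_le
      interval_cases p; omega
    exact_mod_cast this
  have hj0 : j ≠ 0 := by rintro rfl; simp at hj
  have hmul : quadraticChar (ZMod p) 2 * quadraticChar (ZMod p) j = 1 := by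
    rw [← map_mul, show 2 * j = (1 + j) ^ 2 by linear_combination hj]
    refine quadraticChar_sq_one' fun h => ?_
    have : 2 * j = 0 := by rw [show 2 * j = (1 + j) ^ 2 by linear_combination hj, h]; simp
    rcases mul_eq_zero.1 this with h | h <;> contradiction
  rw [hj, map_mul, ← pow_two, quartic_sq_apply hχ]
  congr 1
  rcases quadraticChar_dichotomy h2 with h | h <;> rw [h] at hmul ⊢ <;> linarith

lemma quartic_four (hχ : orderOf χ = 4) : χ 4 = χ (-1) := by
  rw [quartic_neg_one hχ, ← quartic_sq_apply hχ, ← map_pow]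
  norm_num

lemma quartic_neg_one_eq (hχ : orderOf χ = 4) : χ (-1) = if p % 8 = 1 then 1 else -1 := by
  have hp := quartic_mod_four hχ
  have h2 : ringChar (ZMod p) ≠ 2 := by rw [ZMod.ringChar_zmod_n]; omega
  rw [quartic_neg_one hχ, quadraticChar_two h2, ZMod.card, ZMod.χ₈_nat_eq_if_mod_eight]
  have : p % 2 = 1 := by omega
  have h7 : p % 8 ≠ 7 := by omega
  simp only [this, h7, or_false]
  split_ifs <;> simp_all

lemma MulChar.neg_one_mul_self {R S : Type*} [CommRing R] [CommRing S] (χ : MulChar R S) :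
    χ (-1) * χ (-1) = 1 := by
  rw [← map_mul]; simp

lemma jacobiSum_quartic_mul_star (hχ : orderOf χ = 4) :
    jacobiSum χ (χ ^ 2) * star (jacobiSum χ (χ ^ 2)) = (p : GaussianInt) := by
  have hpp : p.Prime := Fact.out
  set f := GaussianInt.toComplex
  have hf : Function.Injective f := GaussianInt.toComplex_injective
  apply hf
  have h1 : χ ≠ 1 := by rintro rfl; simp at hχ
  have h2 : χ ^ 2 ≠ 1 := by
    intro h; have := orderOf_dvd_of_pow_eq_one h; rw [hχ] at this; omega
  have h3 : χ * χ ^ 2 ≠ 1 := by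
    rw [← pow_succ']
    intro h; have := orderOf_dvd_of_pow_eq_one h; rw [hχ] at this; omega
  have key := jacobiSum_mul_jacobiSum_inv (F := ZMod p) (F' := ℂ)
    (χ := χ.ringHomComp f) (φ := (χ ^ 2).ringHomComp f)
    (by rw [ZMod.ringChar_zmod_n, ringChar.eq ℂ 0]; exact hpp.ne_zero.symm)
    ((MulChar.ringHomComp_ne_one_iff hf).2 h1) ((MulChar.ringHomComp_ne_one_iff hf).2 h2)
    (by rw [← MulChar.ringHomComp_mul]; exact (MulChar.ringHomComp_ne_one_iff hf).2 h3)
  have hinv : χ⁻¹ = χ.ringHomComp (starRingEnd GaussianInt) := quartic_inv hχ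
  rw [MulChar.ringHomComp_inv, MulChar.ringHomComp_inv, jacobiSum_ringHomComp,
    jacobiSum_ringHomComp, ← inv_pow, hinv, MulChar.ringHomComp_pow, jacobiSum_ringHomComp,
    ZMod.card] at key
  rw [map_mul, map_natCast]
  exact key

/-- The congruence `J(χ, χ²) ≡ -p` modulo `2 (1 - i)`: as both characters sum to zero, the sum
`J(χ, χ²) + p` equals that of the products `(χ x - 1) (χ² (1 - x) - 1)`. -/
lemma jacobiSum_quartic_dvd (hχ : orderOf χ = 4) :
    (2 * ⟨1, -1⟩ : GaussianInt) ∣ jacobiSum χ (χ ^ 2) + p := by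
  have h1 : χ ≠ 1 := by rintro rfl; simp at hχ
  have h2 : χ ^ 2 ≠ 1 := by
    intro h; have := orderOf_dvd_of_pow_eq_one h; rw [hχ] at this; omega
  have hsum : jacobiSum χ (χ ^ 2) + p = ∑ x, (χ x - 1) * ((χ ^ 2) (1 - x) - 1) := by
    have hs : ∑ x, (χ ^ 2) (1 - x) = 0 := by
      rw [← MulChar.sum_eq_zero_of_ne_one h2]
      exact (Equiv.subLeft (1 : ZMod p)).sum_comp (χ ^ 2 : MulChar (ZMod p) GaussianInt)
    simp_rw [sub_mul, mul_sub, mul_one, one_mul]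
    rw [Finset.sum_sub_distrib, Finset.sum_sub_distrib, Finset.sum_sub_distrib, hs,
      MulChar.sum_eq_zero_of_ne_one h1, jacobiSum]
    simp [ZMod.card]
  rw [hsum]
  refine Finset.dvd_sum fun x _ => ?_
  rcases eq_or_ne x 0 with rfl | hx
  · simp
  rcases eq_or_ne x 1 with rfl | hx1
  · simp
  have hx1 : 1 - x ≠ 0 := sub_ne_zero.2 hx1.symm
  rw [mul_comm]
  refine mul_dvd_mul ?_ ?_
  · rcases GaussianInt.eq_of_pow_four_eq_one (quartic_pow_four hχ hx) with h | h | h | h <;> rw [h]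
    · simp
    · exact ⟨-⟨1, 1⟩, by decide⟩
    · exact ⟨-1, by decide⟩
    · exact ⟨-⟨0, 1⟩, by decide⟩
  · rw [MulChar.pow_apply' _ (by norm_num), quartic_sq_apply hχ]
    rcases quadraticChar_dichotomy hx1 with h | h <;> rw [h]
    · simp
    · exact ⟨-1, by norm_num⟩

end QuarticChar

/-- A prime is in at most one way the sum of two squares. -/
lemma Int.sq_eq_sq_of_prime_eq_sq_add_sq {p : ℕ} (hp : p.Prime) {a b c d : ℤ}
    (h1 : (p : ℤ) = a ^ 2 + b ^ 2) (h2 : (p : ℤ) = c ^ 2 + d ^ 2)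
    (ha : Odd a) (hb : Even b) (hc : Odd c) : c ^ 2 = a ^ 2 ∧ d ^ 2 = b ^ 2 := by
  have hpp : Prime (p : ℤ) := Nat.prime_iff_prime_int.1 hp
  have hp0 : (p : ℤ) ≠ 0 := hpp.ne_zero
  have hdvd : (p : ℤ) ∣ (c * b - a * d) * (c * b + a * d) :=
    ⟨c ^ 2 - a ^ 2, by linear_combination (-c ^ 2) * h1 + a ^ 2 * h2⟩
  have main : ∀ s : ℤ, s ^ 2 = 1 → (p : ℤ) ∣ c * b + s * a * d → c ^ 2 = a ^ 2 := by
    intro s hs ⟨k, hk⟩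
    have hsq : (c * a - s * b * d) ^ 2 + (c * b + s * a * d) ^ 2 = (p : ℤ) ^ 2 := by
      linear_combination (-p : ℤ) * h1 - (a ^ 2 + b ^ 2) * h2 +
        (b ^ 2 * d ^ 2 + a ^ 2 * d ^ 2) * hs
    have hodd : Odd (c * a - s * b * d) :=
      (hc.mul ha).sub_even ((hb.mul_left s).mul_right d)
    have hne : c * a - s * b * d ≠ 0 := by
      intro h; rw [h] at hodd; simp at hodd
    -- The first square is nonzero, so the second, a multiple of `p ^ 2`, vanishes.
    have hk0 : k = 0 := by
      by_contra hk0
      have hk1 : 1 ≤ k ^ 2 := by have := sq_pos_of_ne_zero hk0; omega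
      have hpos := sq_pos_of_ne_zero hne
      rw [hk] at hsq
      have : (p : ℤ) ^ 2 * 1 ≤ (p : ℤ) ^ 2 * k ^ 2 :=
        mul_le_mul_of_nonneg_left hk1 (sq_nonneg _)
      nlinarith
    rw [hk0, mul_zero] at hk
    have h3 : c ^ 2 * b ^ 2 = a ^ 2 * d ^ 2 := by
      linear_combination (c * b - s * a * d) * hk + a ^ 2 * d ^ 2 * hs
    refine mul_left_cancel₀ hp0 ?_
    linear_combination c ^ 2 * h1 - a ^ 2 * h2 + h3
  have hca : c ^ 2 = a ^ 2 := by
    rcases hpp.dvd_or_dvd hdvd with h | h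
    · exact main (-1) (by norm_num) (by rwa [show c * b + -1 * a * d = c * b - a * d by ring])
    · exact main 1 (by norm_num) (by rwa [one_mul])
  exact ⟨hca, by linarith⟩

/-- For a prime `p = α² + x²` with `α ≡ 1 (mod 4)` some quartic character has the Jacobi sum
`-χ(-1) (α + x i)`; the congruence modulo `2 (1 - i)` fixes the sign of the real part, and passing
to the conjugate character that of the imaginary part. -/
theorem exists_quarticChar {p : ℕ} [Fact p.Prime] {α x : ℤ} (hp : (p : ℤ) = α ^ 2 + x ^ 2)
    (hα : α ≡ 1 [ZMOD 4]) (hx : Even x) :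
    ∃ χ : MulChar (ZMod p) GaussianInt, orderOf χ = 4 ∧
      jacobiSum χ (χ ^ 2) = -χ (-1) * ⟨α, x⟩ := by
  have hpp : p.Prime := Fact.out
  have hα2 : Odd α := by
    rw [Int.odd_iff]; have := hα.eq; omega
  have hp4 : p % 4 = 1 := by
    obtain ⟨y, rfl⟩ := hx
    obtain ⟨z, rfl⟩ := hα2
    have : (p : ℤ) = 1 + 4 * (z ^ 2 + z + y ^ 2) := by rw [hp]; ring
    omega
  obtain ⟨χ, hχ⟩ := MulChar.exists_mulChar_orderOf (ZMod p) (n := 4) (R := GaussianInt)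
    (by rw [ZMod.card]; omega) GaussianInt.isPrimitiveRoot_I
  set J := jacobiSum χ (χ ^ 2) with hJ
  obtain ⟨z, hz⟩ := jacobiSum_quartic_dvd hχ
  have hre : J.re = 2 * (z.re + z.im) - p := by
    have := congrArg Zsqrtd.re hz
    simp at this
    linarith
  have him : J.im = 2 * (z.im - z.re) := by
    have := congrArg Zsqrtd.im hz
    simp at this
    linarith
  have hnorm : (p : ℤ) = J.re ^ 2 + J.im ^ 2 := by
    have := congrArg Zsqrtd.re (jacobiSum_quartic_mul_star hχ)
    simp at this
    linarith
  have hodd : Odd J.re := by rw [Int.odd_iff]; omega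
  obtain ⟨h1, h2⟩ := Int.sq_eq_sq_of_prime_eq_sq_add_sq hpp hp hnorm hα2 hx hodd
  have hα4 := hα.eq
  -- Modulo 8 the equation `p = re² + im²` decides whether `z.re + z.im` is even.
  have hJre : J.re = -(if p % 8 = 1 then 1 else -1) * α := by
    obtain ⟨r, hr⟩ := hodd
    obtain ⟨u, hu⟩ : ∃ u, r ^ 2 + r = 2 * u := by
      obtain ⟨u, hu⟩ := Int.even_mul_succ_self r
      exact ⟨u, by linarith⟩
    have h8 : (p : ℤ) = 1 + 8 * u + 4 * (z.im - z.re) ^ 2 := by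
      rw [hnorm, him, hr]; linear_combination 4 * hu
    rcases sq_eq_sq_iff_eq_or_eq_neg.1 h1 with h | h
    all_goals
      rcases Int.even_or_odd' (z.im - z.re) with ⟨k, hk | hk⟩
      all_goals
        rw [hk] at h8
        try have h11 : (p : ℤ) = 1 + 8 * u + 16 * k ^ 2 := by linear_combination h8
        try have h11 : (p : ℤ) = 5 + 8 * u + 16 * (k ^ 2 + k) := by linear_combination h8
        generalize k ^ 2 = kk at h11
        split_ifs with h9 <;> omega
  have hsq : χ (-1) = ((if p % 8 = 1 then 1 else -1 : ℤ) : GaussianInt) := by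
    rw [quartic_neg_one_eq hχ]; split_ifs <;> simp
  set s : ℤ := if p % 8 = 1 then 1 else -1 with hs
  have hs2 : s = 1 ∨ s = -1 := by rw [hs]; split_ifs <;> simp
  have hJim : J.im = -s * x ∨ J.im = s * x := by
    rcases sq_eq_sq_iff_eq_or_eq_neg.1 h2 with h | h <;> rcases hs2 with h' | h' <;> rw [h, h'] <;>
      simp
  rcases hJim with h | h
  · refine ⟨χ, hχ, ?_⟩
    rw [hsq]
    ext <;> simp [← hJ, hJre, h]
  · refine ⟨χ⁻¹, by rw [orderOf_inv, hχ], ?_⟩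
    have hJ' : jacobiSum χ⁻¹ (χ⁻¹ ^ 2) = star J := by
      rw [quartic_inv hχ, MulChar.ringHomComp_pow, jacobiSum_ringHomComp]; rfl
    have hm : χ⁻¹ (-1) = χ (-1) := by rw [MulChar.inv_apply', inv_neg_one]
    rw [hJ', hm, hsq]
    ext <;> simp [hJre, h]

/-! ### The trace of Frobenius of `y² = x³ + D x` -/

lemma frobeniusTrace_eq_neg_sum {D : ℤ} {p : ℕ} [Fact p.Prime] (hp2 : p ≠ 2)
    (hD : ¬ (p : ℤ) ∣ D) :
    frobeniusTrace D p = -∑ x : ZMod p, quadraticChar (ZMod p) (x ^ 3 + D * x) := by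
  classical
  have h2 : ringChar (ZMod p) ≠ 2 := by rwa [ZMod.ringChar_zmod_n]
  have hD0 : (D : ZMod p) ≠ 0 := by rwa [Ne, ZMod.intCast_zmod_eq_zero_iff_dvd]
  have h20 : (2 : ZMod p) ≠ 0 := Ring.two_ne_zero h2
  set W := ((curveE D).map (Int.castRingHom (ZMod p))).toAffine with hW
  have hΔ : W.Δ ≠ 0 := by
    have : W.Δ = -(2 ^ 6 * (D : ZMod p) ^ 3) := by
      simp [hW, curveE, WeierstrassCurve.Δ, WeierstrassCurve.b₂, WeierstrassCurve.b₄,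
        WeierstrassCurve.b₆, WeierstrassCurve.b₈]
      ring
    rw [this]
    exact neg_ne_zero.2 (mul_ne_zero (pow_ne_zero _ h20) (pow_ne_zero _ hD0))
  have heq : ∀ x y : ZMod p, W.Nonsingular x y ↔ y ^ 2 = x ^ 3 + D * x := by
    intro x y
    rw [← WeierstrassCurve.Affine.equation_iff_nonsingular_of_Δ_ne_zero hΔ,
      WeierstrassCurve.Affine.equation_iff]
    simp [hW, curveE]
  let e : W.Point ≃ Option (Σ x : ZMod p, {y : ZMod p // y ^ 2 = x ^ 3 + D * x}) :=
    { toFun := fun P => match P with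
        | .zero => none
        | .some x y h => some ⟨x, y, (heq x y).1 h⟩
      invFun := fun P => match P with
        | none => .zero
        | some ⟨x, y, h⟩ => .some x y ((heq x y).2 h)
      left_inv := by rintro (_ | _) <;> rfl
      right_inv := by rintro (_ | _) <;> rfl }
  have hcard : ∀ x : ZMod p, (Fintype.card {y : ZMod p // y ^ 2 = x ^ 3 + D * x} : ℤ)
      = quadraticChar (ZMod p) (x ^ 3 + D * x) + 1 := by
    intro x
    rw [← quadraticChar_card_sqrts h2, Set.toFinset_card]
    rfl
  rw [frobeniusTrace, ← hW, Nat.card_congr e, Nat.card_eq_fintype_card, Fintype.card_option,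
    Fintype.card_sigma]
  push_cast
  rw [Finset.sum_congr rfl fun x _ => hcard x, Finset.sum_add_distrib]
  simp only [Finset.sum_const, Finset.card_univ, ZMod.card, nsmul_eq_mul, mul_one]
  ring

lemma sum_comp_sq {F R : Type*} [Field F] [Fintype F] [DecidableEq F] [CommRing R]
    (hF : ringChar F ≠ 2) (f : F → R) :
    ∑ x, f (x ^ 2) = ∑ y, (1 + (quadraticChar F y : R)) * f y := by
  rw [← Finset.sum_fiberwise (s := Finset.univ) (g := fun x : F => x ^ 2)]
  refine Finset.sum_congr rfl fun y _ => ?_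
  rw [Finset.sum_congr rfl (g := fun _ => f y) fun x hx => by rw [(Finset.mem_filter.1 hx).2],
    Finset.sum_const, nsmul_eq_mul]
  congr 1
  have := quadraticChar_card_sqrts hF y
  rw [add_comm, ← Int.cast_one (R := R), ← Int.cast_add, ← this, Int.cast_natCast]
  congr 2
  ext x; simp

section Trace

variable {p : ℕ} [Fact p.Prime] {χ : MulChar (ZMod p) GaussianInt}

lemma sum_quartic_mul_quadraticChar_add (hχ : orderOf χ = 4) {d : ZMod p} (hd : d ≠ 0) :
    ∑ y, χ y * (quadraticChar (ZMod p) (y + d) : GaussianInt) =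
      χ (-1) * χ d ^ 3 * jacobiSum χ (χ ^ 2) := by
  rw [← Equiv.sum_comp (Equiv.mulLeft₀ (-d) (neg_ne_zero.2 hd)), jacobiSum, Finset.mul_sum]
  refine Finset.sum_congr rfl fun z _ => ?_
  rw [show Equiv.mulLeft₀ (-d) (neg_ne_zero.2 hd) z = -d * z from rfl,
    show -d * z + d = d * (1 - z) by ring, ← quartic_sq_apply hχ,
    MulChar.pow_apply' _ (by norm_num), show -d * z = -1 * d * z by ring]
  simp only [map_mul]
  ring

/-- The substitution `y = x²` turns the sum over `x` into two conjugate Jacobi sums. -/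
theorem frobeniusTrace_eq_re (hχ : orderOf χ = 4) {D α x : ℤ} (hD : ¬ (p : ℤ) ∣ D)
    (hJ : jacobiSum χ (χ ^ 2) = -χ (-1) * ⟨α, x⟩) :
    frobeniusTrace D p = 2 * (χ D ^ 3 * ⟨α, x⟩ : GaussianInt).re := by
  have hp4 := quartic_mod_four hχ
  have hp2 : p ≠ 2 := by omega
  have h2 : ringChar (ZMod p) ≠ 2 := by rwa [ZMod.ringChar_zmod_n]
  have hD0 : (D : ZMod p) ≠ 0 := by rwa [Ne, ZMod.intCast_zmod_eq_zero_iff_dvd]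
  rw [frobeniusTrace_eq_neg_sum hp2 hD]
  set w : GaussianInt := χ D ^ 3 * ⟨α, x⟩ with hw
  have hS : ∑ y, χ y * (quadraticChar (ZMod p) (y + D) : GaussianInt) = -w := by
    rw [sum_quartic_mul_quadraticChar_add hχ hD0, hJ, hw]
    linear_combination (-χ D ^ 3 * ⟨α, x⟩) * MulChar.neg_one_mul_self χ
  have hS' : ∑ y, χ y ^ 3 * (quadraticChar (ZMod p) (y + D) : GaussianInt) = -star w := by
    rw [← star_neg, ← hS, star_sum]
    refine Finset.sum_congr rfl fun y _ => ?_
    rw [star_mul', star_intCast]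
    have h3 : χ y ^ 3 = star (χ y) := by
      rcases eq_or_ne y 0 with rfl | hy
      · rw [MulChar.map_zero, star_zero, zero_pow (by norm_num)]
      · have h4 := quartic_pow_four hχ hy
        linear_combination star (χ y) * h4 - χ y ^ 3 * GaussianInt.mul_star_of_pow_four_eq_one h4
    rw [h3]
  have hsum : ((∑ y : ZMod p, quadraticChar (ZMod p) (y ^ 3 + D * y) : ℤ) : GaussianInt) =
      -w - star w := by
    have h1 : ∀ y : ZMod p, ((quadraticChar (ZMod p) (y ^ 3 + D * y) : ℤ) : GaussianInt) =
        χ (y ^ 2) * (quadraticChar (ZMod p) (y ^ 2 + D) : GaussianInt) := by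
      intro y
      rw [show y ^ 3 + D * y = y * (y ^ 2 + D) by ring, map_mul, map_pow χ, quartic_sq_apply hχ]
      push_cast; rfl
    push_cast
    rw [Finset.sum_congr rfl fun y _ => h1 y,
      sum_comp_sq h2 fun y => χ y * (quadraticChar (ZMod p) (y + D) : GaussianInt)]
    simp_rw [← quartic_sq_apply hχ, add_mul, one_mul]
    rw [Finset.sum_add_distrib]
    simp_rw [quartic_sq_apply hχ]
    rw [hS, sub_eq_add_neg, ← hS']
    congr 1
    refine Finset.sum_congr rfl fun y _ => ?_
    rw [← quartic_sq_apply hχ y]; ring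
  have := congrArg Zsqrtd.re hsum
  simp only [Zsqrtd.re_intCast, Zsqrtd.re_sub, Zsqrtd.re_neg, Zsqrtd.re_star] at this
  linarith

/-- A prime `p = α² + x²` has trace `2 α` (resp. `-2 α`) precisely when the quartic character
attached to `α + x i` takes the value `1` (resp. `-1`) at `D`. -/
theorem frobeniusTrace_eq_iff (hχ : orderOf χ = 4) {D α x : ℤ} (hD : ¬ (p : ℤ) ∣ D)
    (hJ : jacobiSum χ (χ ^ 2) = -χ (-1) * ⟨α, x⟩) (hα : Odd α) (hx : Even x) :
    (frobeniusTrace D p = 2 * α ↔ χ D = 1) ∧ (frobeniusTrace D p = 2 * -α ↔ χ D = -1) := by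
  have hD0 : (D : ZMod p) ≠ 0 := by rwa [Ne, ZMod.intCast_zmod_eq_zero_iff_dvd]
  have hα1 := Int.odd_iff.1 hα
  have hx1 := Int.even_iff.1 hx
  rw [frobeniusTrace_eq_re hχ hD hJ]
  rcases GaussianInt.eq_of_pow_four_eq_one (quartic_pow_four hχ hD0) with h | h | h | h <;>
    rw [h] <;> simp [pow_succ, Zsqrtd.ext_iff] <;> omega

end Trace

/-! ### Reciprocity for quartic characters at rational primes -/

section GaussSum

variable {p : ℕ} [Fact p.Prime] {χ : MulChar (ZMod p) GaussianInt}
  {K : Type*} [Field K] (f : GaussianInt →+* K)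

lemma orderOf_quartic_ringHomComp (hχ : orderOf χ = 4) (h2 : (2 : K) ≠ 0) :
    orderOf (χ.ringHomComp f) = 4 := by
  have hp4 := quartic_mod_four hχ
  have hp2 : ringChar (ZMod p) ≠ 2 := by rw [ZMod.ringChar_zmod_n]; omega
  refine orderOf_eq_prime_pow (p := 2) (n := 1) ?_ ?_
  · obtain ⟨a, ha⟩ := quadraticChar_exists_neg_one' hp2
    intro h
    have h1 : (χ.ringHomComp f ^ 2 ^ 1) a = 1 := by rw [h, MulChar.one_apply_coe]
    rw [pow_one, MulChar.pow_apply_coe, MulChar.ringHomComp_apply, ← map_pow,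
      quartic_sq_apply hχ, ha] at h1
    apply h2
    have h3 : (-1 : K) = 1 := by simpa using h1
    linear_combination -h3
  · rw [show 2 ^ (1 + 1) = 4 by norm_num, MulChar.ringHomComp_pow, ← hχ, pow_orderOf_eq_one,
      MulChar.ringHomComp_one]

/-- The fourth power of a quartic Gauss sum is `p J(χ, χ²)²`; being even in the Jacobi sum, it does
not see its sign. -/
lemma gaussSum_quartic_pow_four (hχ : orderOf χ = 4) (h2 : (2 : K) ≠ 0) (hp : (p : K) ≠ 0)
    {ψ : AddChar (ZMod p) K} (hψ : ψ.IsPrimitive) {w : GaussianInt}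
    (hJ : jacobiSum χ (χ ^ 2) = -χ (-1) * w) :
    gaussSum (χ.ringHomComp f) ψ ^ 4 = p * f w ^ 2 := by
  set η := χ.ringHomComp f with hη
  have hord : orderOf η = 4 := orderOf_quartic_ringHomComp f hχ h2
  have hne : ∀ k, ¬ 4 ∣ k → η ^ k ≠ 1 := fun k hk h =>
    hk (hord ▸ orderOf_dvd_of_pow_eq_one h)
  have hη1 : η ≠ 1 := by simpa using hne 1 (by norm_num)
  have hneg : η (-1) * η (-1) = 1 := MulChar.neg_one_mul_self η
  have h3 : gaussSum η ψ * gaussSum (η ^ 3) ψ = η (-1) * p := by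
    have := gaussSum_mul_gaussSum_pow_orderOf_sub_one hη1 hψ
    rwa [hord, ZMod.card] at this
  have hq : gaussSum (η ^ 2) ψ ^ 2 = p := by
    have hquad : (η ^ 2).IsQuadratic := by
      rw [MulChar.isQuadratic_iff_sq_eq_one, ← pow_mul, show 2 * 2 = orderOf η from hord.symm,
        pow_orderOf_eq_one]
    rw [gaussSum_sq (hne 2 (by norm_num)) hquad hψ, ZMod.card, MulChar.pow_apply' _ (by norm_num),
      pow_two, hneg, one_mul]
  have hJK : jacobiSum η (η ^ 2) = -η (-1) * f w := by
    rw [hη, MulChar.ringHomComp_pow, jacobiSum_ringHomComp, hJ]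
    simp
  have hjac := jacobiSum_mul_nontrivial (χ := η) (φ := η ^ 2)
    (by rw [← pow_succ']; exact hne 3 (by norm_num)) ψ
  rw [← pow_succ', hJK] at hjac
  norm_num at hjac
  set g := gaussSum η ψ
  set g2 := gaussSum (η ^ 2) ψ
  set g3 := gaussSum (η ^ 3) ψ
  have h5 : g ^ 2 * g2 = -(p * f w) := by
    linear_combination (-g) * hjac - η (-1) * f w * h3 - (p * f w) * hneg
  refine mul_right_cancel₀ hp ?_
  linear_combination (g ^ 2 * g2 - p * f w) * h5 - g ^ 4 * hq

end GaussSum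

/-- The prime `l`, with the sign that makes it congruent to `1` modulo `4`. -/
def primeStar (l : ℕ) : ℤ := if l % 4 = 1 then l else -l

/-- A quarter of the order `l ∓ 1` of the norm-one group of `𝔽_l[i]`, which consists of the values
of `(α + y i) / (α - y i)` together with `-1`. -/
def normOneQuarter (l : ℕ) : ℕ := if l % 4 = 1 then (l - 1) / 4 else (l + 1) / 4

lemma normOneQuarter_pos {l : ℕ} (hl : 2 < l) (hodd : l % 2 = 1) : 0 < normOneQuarter l := by
  unfold normOneQuarter; split_ifs <;> omega

lemma tauPrimePow_add_one {l : ℕ} (hl : 2 < l) (hodd : l % 2 = 1) :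
    tauPrimePow l 1 + 1 = 4 * normOneQuarter l := by
  unfold tauPrimePow normOneQuarter; split_ifs <;> simp <;> omega

section Frobenius

variable {l : ℕ} [Fact l.Prime] {K : Type*} [Field K] {j : K}

lemma pow_prime_of_sq_eq_neg_one (hl : l ≠ 2) (hj : j ^ 2 = -1) :
    j ^ l = if l % 4 = 1 then j else -j := by
  have hodd := (Fact.out : l.Prime).eq_two_or_odd.resolve_left hl
  have h4 : j ^ 4 = 1 := by linear_combination (j ^ 2 - 1) * hj
  rw [← Nat.mod_add_div l 4, pow_add, pow_mul, h4, one_pow, mul_one]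
  have : l % 4 = 1 ∨ l % 4 = 3 := by omega
  rcases this with h | h
  · simp [h]
  · simp [h]; linear_combination j * hj

variable [CharP K l]

lemma add_mul_pow_char (hl : l ≠ 2) (hj : j ^ 2 = -1) {a y : K} (ha : a ^ l = a) (hy : y ^ l = y) :
    (a + y * j) ^ l = if l % 4 = 1 then a + y * j else a - y * j := by
  rw [add_pow_char, mul_pow, ha, hy, pow_prime_of_sq_eq_neg_one hl hj]
  split_ifs <;> ring

/-- Raising to the power `l ∓ 1` does not distinguish `a + y i` from its conjugate. -/
lemma add_mul_pow_four_mul_quarter (hl : l ≠ 2) (hj : j ^ 2 = -1) {a y : K} (ha : a ^ l = a)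
    (hy : y ^ l = y) (h0 : a + y * j ≠ 0) :
    (a + y * j) ^ (4 * normOneQuarter l) = if l % 4 = 1 then 1 else (a + y * j) * (a - y * j) := by
  have hodd := (Fact.out : l.Prime).eq_two_or_odd.resolve_left hl
  have h2 := (Fact.out : l.Prime).two_le
  have h := add_mul_pow_char hl hj ha hy
  unfold normOneQuarter
  split_ifs at h ⊢ with h1
  · refine mul_right_cancel₀ h0 ?_
    rw [← pow_succ, one_mul, show 4 * ((l - 1) / 4) + 1 = l by omega, h]
  · rw [show 4 * ((l + 1) / 4) = l + 1 by omega, pow_succ, h, mul_comm]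

end Frobenius

section Reciprocity

variable {p l : ℕ} [Fact p.Prime] [Fact l.Prime] {χ : MulChar (ZMod p) GaussianInt}
  {K : Type*} [Field K] [CharP K l]

/-- Quartic reciprocity at a rational prime `l`: comparing the Frobenius action on the Gauss sum
with its fourth power yields the value of `χ` at `±l` as a power of `(α + x i) / (α - x i)` in
characteristic `l`. -/
theorem quartic_reciprocity [IsAlgClosed K] (hl : l ≠ 2) (hpl : p ≠ l) (f : GaussianInt →+* K)
    {α x : ℤ} (hp : (p : ℤ) = α ^ 2 + x ^ 2) (hχ : orderOf χ = 4)
    (hJ : jacobiSum χ (χ ^ 2) = -χ (-1) * ⟨α, x⟩) {j : K}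
    (hj : j = if l % 4 = 1 then f ⟨0, 1⟩ else -f ⟨0, 1⟩) :
    f (χ (primeStar l)) * (α - x * j) ^ normOneQuarter l = (α + x * j) ^ normOneQuarter l := by
  have hlp : l.Prime := Fact.out
  have hpp : p.Prime := Fact.out
  have hodd := hlp.eq_two_or_odd.resolve_left hl
  have hl2 := hlp.two_le
  have h2 : (2 : K) ≠ 0 := Ring.two_ne_zero (by rwa [ringChar.eq K l])
  have hpK : (p : K) ≠ 0 := by
    rw [Ne, CharP.cast_eq_zero_iff K l, Nat.prime_dvd_prime_iff_eq hlp hpp]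
    exact hpl.symm
  have hlu : IsUnit ((l : ℕ) : ZMod p) := by
    rw [isUnit_iff_ne_zero, Ne, ZMod.natCast_eq_zero_iff, Nat.prime_dvd_prime_iff_eq hpp hlp]
    exact hpl
  have : NeZero (p : K) := ⟨hpK⟩
  obtain ⟨ζ, hζ⟩ := HasEnoughRootsOfUnity.exists_primitiveRoot K p
  have hψ := AddChar.zmodChar_primitive_of_primitive_root p hζ
  set ψ := AddChar.zmodChar p ((IsPrimitiveRoot.iff_def ζ p).mp hζ).left
  set η := χ.ringHomComp f with hη
  have hord : orderOf η = 4 := orderOf_quartic_ringHomComp f hχ h2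
  have hη1 : η ≠ 1 := by rintro h; simp [h] at hord
  set i : K := f ⟨0, 1⟩ with hi
  have hi2 : i ^ 2 = -1 := by
    rw [hi, ← map_pow, show (⟨0, 1⟩ : GaussianInt) ^ 2 = -1 by decide]; simp
  have hw : f ⟨α, x⟩ = α + x * i := by
    rw [show (⟨α, x⟩ : GaussianInt) = (α : GaussianInt) + (x : GaussianInt) * ⟨0, 1⟩ by
      ext <;> simp, map_add, map_mul, map_intCast, map_intCast]
  have hg4 := gaussSum_quartic_pow_four f hχ h2 hpK hψ hJ
  have hAB : (p : K) = (α + x * i) * (α - x * i) := by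
    have : (p : K) = (α : K) ^ 2 + (x : K) ^ 2 := by exact_mod_cast congrArg (Int.cast : ℤ → K) hp
    linear_combination this + (x : K) ^ 2 * hi2
  rw [hw, hAB] at hg4
  have hint : ∀ n : ℤ, (n : K) ^ l = n := fun n => by
    rw [← map_intCast (ZMod.castHom dvd_rfl K), ← map_pow, ZMod.pow_card]
  have hA0 : (α : K) + x * i ≠ 0 := left_ne_zero_of_mul (hAB ▸ hpK)
  have hpow := add_mul_pow_four_mul_quarter hl hi2 (hint α) (hint x) hA0
  have hfrob : (η ^ l) (l : ZMod p) * gaussSum η ψ ^ l = gaussSum (η ^ l) ψ := by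
    rw [gaussSum_frob, AddChar.pow_mulShift]
    exact gaussSum_mulShift (η ^ l) ψ hlu.unit
  have hc4 : η (l : ZMod p) ^ 4 = 1 := by
    rw [hη, MulChar.ringHomComp_apply, ← map_pow, quartic_pow_four hχ hlu.ne_zero, map_one]
  have hd2 : η (-1) * η (-1) = 1 := MulChar.neg_one_mul_self η
  have hηl : η ^ l = η ^ (l % 4) := by rw [← hord, pow_mod_orderOf]
  have hg0 : gaussSum η ψ ≠ 0 := by
    apply gaussSum_ne_zero_of_nontrivial _ hη1 hψ
    rwa [ZMod.card]
  rw [hηl] at hfrob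
  set m := normOneQuarter l with hm
  have hgm : gaussSum η ψ ^ (4 * m) = ((α + x * i) ^ m) ^ 3 * (α - x * i) ^ m := by
    rw [pow_mul, hg4]
    generalize (α + x * i : K) = A
    generalize (α - x * i : K) = B
    ring
  set g := gaussSum η ψ
  have hA30 : ((α + x * i : K) ^ m) ^ 3 ≠ 0 := pow_ne_zero _ (pow_ne_zero _ hA0)
  have hpow' : ((α + x * i : K) ^ m) ^ 4 = if l % 4 = 1 then 1 else
      (α + x * i) * (α - x * i) := by rw [← hpow]; ring
  -- Frobenius fixes the Gauss sum of `η` up to a factor if `l ≡ 1 (mod 4)`, and otherwise sends it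
  -- to that of `η ^ 3 = η⁻¹`.
  by_cases h1 : l % 4 = 1
  · rw [if_pos h1] at hj hpow'
    rw [h1, pow_one] at hfrob
    have h4m : 4 * m + 1 = l := by rw [hm, normOneQuarter, if_pos h1]; omega
    have h6 : η (l : ZMod p) * g ^ (4 * m) = 1 := by
      refine mul_right_cancel₀ hg0 ?_
      rw [mul_assoc, ← pow_succ, h4m, hfrob, one_mul]
    rw [hgm] at h6
    have h7 : f (χ (primeStar l)) = η (l : ZMod p) := by
      rw [primeStar, if_pos h1, hη, MulChar.ringHomComp_apply]; simp
    rw [h7, hj]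
    refine mul_right_cancel₀ hA30 ?_
    linear_combination h6 - hpow'
  · rw [if_neg h1] at hj hpow'
    rw [show l % 4 = 3 by omega] at hfrob
    have h4m : 4 * m = l + 1 := by rw [hm, normOneQuarter, if_neg h1]; omega
    have h3 : g * gaussSum (η ^ 3) ψ = η (-1) * p := by
      have := gaussSum_mul_gaussSum_pow_orderOf_sub_one hη1 hψ
      rwa [hord, ZMod.card] at this
    have h6 : η (l : ZMod p) ^ 3 * g ^ (4 * m) = η (-1) * p := by
      rw [h4m, ← h3, ← hfrob, MulChar.pow_apply' _ (by norm_num)]; ring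
    rw [hgm, hAB] at h6
    have h7 : f (χ (primeStar l)) = η (-1) * η (l : ZMod p) := by
      rw [primeStar, if_neg h1, hη, MulChar.ringHomComp_apply, MulChar.ringHomComp_apply, ← map_mul,
        ← map_mul]
      simp
    rw [h7, hj]
    simp only [mul_neg, sub_neg_eq_add, ← sub_eq_add_neg]
    refine mul_right_cancel₀ hA30 ?_
    linear_combination η (-1) * η (l : ZMod p) * hpow' - η (l : ZMod p) * h6 +
      ((α + x * i : K) ^ m) ^ 3 * (α - x * i) ^ m * hc4

end Reciprocity

/-! ### The distribution of the quartic symbol over residue classes -/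

section Count

variable {l : ℕ} [Fact l.Prime] {K : Type*} [Field K] [CharP K l] {j : K}

open Polynomial in
/-- The equation `(a + y j) ^ m = ζ (a - y j) ^ m` in `y` has degree at most `m`, and less if `ζ` is
the value `(-1) ^ m` of the quotient at infinity. -/
lemma card_symbol_fiber_le (h2 : (2 : K) ≠ 0) (hj : j ^ 2 = -1) {a : K} (ha : a ≠ 0) {m : ℕ}
    (hm : 0 < m) (ζ : K) (s : Finset (ZMod l))
    (hs : ∀ y ∈ s, (a + ZMod.castHom dvd_rfl K y * j) ^ m =
      ζ * (a - ZMod.castHom dvd_rfl K y * j) ^ m) :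
    s.card ≤ m ∧ (ζ = (-1) ^ m → s.card < m) := by
  set φ := ZMod.castHom (dvd_refl l) K
  set P : K[X] := (C j * X + C a) ^ m - C ζ * (C (-j) * X + C a) ^ m with hP
  have hev : ∀ y, P.eval y = (a + y * j) ^ m - ζ * (a - y * j) ^ m := by
    intro y
    simp only [hP, eval_sub, eval_pow, eval_add, eval_mul, eval_C, eval_X]
    ring_nf
  have hP0 : P ≠ 0 := by
    intro h
    have h1 := hev (-(a * j))
    rw [h, eval_zero, show a + -(a * j) * j = 2 * a by linear_combination (-a) * hj,
      show a - -(a * j) * j = 0 by linear_combination a * hj, zero_pow hm.ne', mul_zero,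
      sub_zero] at h1
    exact pow_ne_zero _ (mul_ne_zero h2 ha) h1.symm
  have hlin : ∀ b : K, ((C b * X + C a) ^ m : K[X]).natDegree ≤ m := fun b =>
    (natDegree_pow_le_of_le m (natDegree_linear_le)).trans (by simp)
  have hdeg : P.natDegree ≤ m :=
    (natDegree_sub_le_of_le (hlin j) ((natDegree_C_mul_le _ _).trans (hlin (-j)))).trans
      (max_self m).le
  have hcard : s.card ≤ P.natDegree := by
    classical
    refine le_trans ?_ (card_roots' P)
    rw [← Finset.card_image_of_injective s φ.injective]
    refine le_trans (Finset.card_le_card fun z hz => ?_) (Multiset.toFinset_card_le P.roots)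
    obtain ⟨y, hy, rfl⟩ := Finset.mem_image.1 hz
    rw [Multiset.mem_toFinset, mem_roots hP0, IsRoot.def, hev, hs y hy, sub_self]
  refine ⟨hcard.trans hdeg, fun hζ => lt_of_le_of_ne (hcard.trans hdeg) fun heq => ?_⟩
  have hdm : P.natDegree = m := le_antisymm hdeg (heq ▸ hcard)
  have hc : ∀ b : K, ((C b * X + C a) ^ m : K[X]).coeff m = b ^ m := fun b => by
    have := coeff_pow_of_natDegree_le (p := (C b * X + C a : K[X])) (m := m) natDegree_linear_le
    simpa using this
  have hcoeff : P.coeff m = 0 := by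
    rw [hP, coeff_sub, coeff_C_mul, hc, hc, hζ, ← mul_pow]
    simp
  rw [← hdm, coeff_natDegree, leadingCoeff_eq_zero] at hcoeff
  exact hP0 hcoeff

lemma card_sq_add_sq_ne_zero (hl : l ≠ 2) {a : ZMod l} (ha : a ≠ 0) :
    (Finset.univ.filter fun y : ZMod l => a ^ 2 + y ^ 2 ≠ 0).card = tauPrimePow l 1 := by
  have hlp : l.Prime := Fact.out
  have h2 : ringChar (ZMod l) ≠ 2 := by rwa [ZMod.ringChar_zmod_n]
  have hodd := hlp.eq_two_or_odd.resolve_left hl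
  have hl2 := hlp.two_le
  have h1 := quadraticChar_card_sqrts h2 (-a ^ 2)
  rw [neg_eq_neg_one_mul, map_mul, quadraticChar_sq_one' ha, mul_one, quadraticChar_neg_one h2,
    ZMod.card, ZMod.χ₄_nat_eq_if_mod_four] at h1
  have h3 : {x : ZMod l | x ^ 2 = -1 * a ^ 2}.toFinset =
      Finset.univ.filter fun y : ZMod l => a ^ 2 + y ^ 2 = 0 := by
    ext y
    simp only [Set.mem_toFinset, Set.mem_ofPred_eq, Finset.mem_filter, Finset.mem_univ, true_and]
    constructor <;> intro h <;> linear_combination h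
  rw [h3] at h1
  have h4 := Finset.card_filter_add_card_filter_not (s := (Finset.univ : Finset (ZMod l)))
    (fun y => a ^ 2 + y ^ 2 = 0)
  rw [Finset.card_univ, ZMod.card] at h4
  change (Finset.univ.filter fun y : ZMod l => ¬ a ^ 2 + y ^ 2 = 0).card = _
  generalize (Finset.univ.filter fun y : ZMod l => a ^ 2 + y ^ 2 = 0).card = u at h1 h4
  generalize (Finset.univ.filter fun y : ZMod l => ¬ a ^ 2 + y ^ 2 = 0).card = v at h4 ⊢
  unfold tauPrimePow
  rcases (show l % 4 = 1 ∨ l % 4 = 3 by omega) with h | h <;>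
    simp [h, hodd] at h1 ⊢ <;> omega

end Count

open GaussianInt in
/-- A power sum of fourth roots of unity, computed from the number of times each occurs. -/
lemma sum_pow_of_card_fibers {ι : Type*} [Fintype ι] {θ : ι → GaussianInt} {m t : ℕ}
    (ht : t + 1 = 4 * m)
    (hcard : (Finset.univ.filter fun y => θ y ≠ 0).card = t)
    (h4 : ∀ y, θ y ≠ 0 → θ y ^ 4 = 1)
    (hle : ∀ u, u ^ 4 = 1 → (Finset.univ.filter fun y => θ y = u).card ≤ m)
    (hlt : (Finset.univ.filter fun y => θ y = (-1) ^ m).card < m) {k : ℕ} (hk : 0 < k) :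
    ∑ y, θ y ^ k = if 4 ∣ k then (t : GaussianInt) else -((-1) ^ m) ^ k := by
  classical
  set U : Finset GaussianInt := {1, -1, ⟨0, 1⟩, ⟨0, -1⟩} with hU
  set N : GaussianInt → ℕ := fun u => (Finset.univ.filter fun y => θ y = u).card with hN
  have hmaps : ∀ y ∈ Finset.univ.filter (fun y => θ y ≠ 0), θ y ∈ U := by
    intro y hy
    simpa [hU] using eq_of_pow_four_eq_one (h4 y (Finset.mem_filter.1 hy).2)
  have hfib : ∀ u ∈ U, ((Finset.univ.filter fun y => θ y ≠ 0).filter fun y => θ y = u) =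
      Finset.univ.filter fun y => θ y = u := by
    intro u hu
    ext y
    simp only [Finset.mem_filter, Finset.mem_univ, true_and, and_iff_right_iff_imp]
    rintro rfl h0
    rw [h0] at hu
    revert hu
    decide
  have hsumU : ∀ F : GaussianInt → GaussianInt,
      ∑ u ∈ U, F u = F 1 + F (-1) + F ⟨0, 1⟩ + F ⟨0, -1⟩ := by
    intro F
    rw [hU, Finset.sum_insert (by decide), Finset.sum_insert (by decide),
      Finset.sum_insert (by decide), Finset.sum_singleton]
    ring
  have htot : N 1 + N (-1) + N ⟨0, 1⟩ + N ⟨0, -1⟩ = t := by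
    rw [← hcard, Finset.card_eq_sum_card_fiberwise hmaps,
      Finset.sum_congr rfl fun u hu => congrArg Finset.card (hfib u hu), hU,
      Finset.sum_insert (by decide), Finset.sum_insert (by decide),
      Finset.sum_insert (by decide), Finset.sum_singleton]
    ring
  have hsum : ∑ y, θ y ^ k = N 1 * 1 ^ k + N (-1) * (-1) ^ k + N ⟨0, 1⟩ * ⟨0, 1⟩ ^ k +
      N ⟨0, -1⟩ * ⟨0, -1⟩ ^ k := by
    rw [← Finset.sum_filter_of_ne (p := fun y => θ y ≠ 0)
      (fun y _ h h0 => h (by rw [h0, zero_pow hk.ne'])), ← Finset.sum_fiberwise_of_maps_to hmaps,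
      ← hsumU fun u => N u * u ^ k]
    refine Finset.sum_congr rfl fun u hu => ?_
    rw [hfib u hu, Finset.sum_congr rfl (g := fun _ => u ^ k) fun y hy => by
      rw [(Finset.mem_filter.1 hy).2], Finset.sum_const, nsmul_eq_mul]
  have l1 := hle 1 (by decide)
  have l2 := hle (-1) (by decide)
  have l3 := hle ⟨0, 1⟩ (by decide)
  have l4 := hle ⟨0, -1⟩ (by decide)
  change N 1 ≤ m at l1
  change N (-1) ≤ m at l2
  change N ⟨0, 1⟩ ≤ m at l3
  change N ⟨0, -1⟩ ≤ m at l4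
  have hI : (⟨0, -1⟩ : GaussianInt) = -⟨0, 1⟩ := by decide
  have hI4 : (⟨0, 1⟩ : GaussianInt) ^ 4 = 1 := by decide
  have hI3 : (⟨0, 1⟩ : GaussianInt) ^ 3 = -⟨0, 1⟩ := by decide
  have hI2 : (⟨0, 1⟩ : GaussianInt) ^ 2 = -1 := by decide
  have key : ∀ s : GaussianInt, s ^ 4 = 1 → ∑ y, θ y ^ k = m * (1 + (-1) ^ k + ⟨0, 1⟩ ^ k +
      (-⟨0, 1⟩) ^ k) - s ^ k →
      ∑ y, θ y ^ k = if 4 ∣ k then (t : GaussianInt) else -s ^ k := by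
    intro s hs h
    have ht' : (t : GaussianInt) = 4 * m - 1 := by
      have : ((t + 1 : ℕ) : GaussianInt) = ((4 * m : ℕ) : GaussianInt) := by rw [ht]
      push_cast at this
      linear_combination this
    have hn : ((-1 : GaussianInt)) ^ 4 = 1 := by norm_num
    have hnI : (-(⟨0, 1⟩ : GaussianInt)) ^ 4 = 1 := by decide
    have hk4 : (4 ∣ k) ↔ k % 4 = 0 := Nat.dvd_iff_mod_eq_zero
    have hred : ∀ z : GaussianInt, z ^ 4 = 1 → z ^ k = z ^ (k % 4) := fun z hz => by
      conv_lhs => rw [← Nat.mod_add_div k 4, pow_add, pow_mul, hz, one_pow, mul_one]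
    rw [h, hred _ hs, hred _ hn, hred _ hI4, hred _ hnI, ht']
    have : k % 4 < 4 := Nat.mod_lt _ (by norm_num)
    simp only [hk4]
    interval_cases k % 4
    · simp; ring
    · simp
    · simp [hI2]
    · rw [neg_pow (⟨0, 1⟩ : GaussianInt), hI3]; norm_num
  rcases Nat.even_or_odd m with he | ho
  · rw [he.neg_one_pow] at hlt ⊢
    change N 1 < m at hlt
    refine key 1 (by norm_num) ?_
    rw [hsum, show N (-1) = m by omega, show N ⟨0, 1⟩ = m by omega, show N ⟨0, -1⟩ = m by omega, hI]
    have : (m : GaussianInt) = N 1 + 1 := by exact_mod_cast (show m = N 1 + 1 by omega)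
    rw [this]; ring
  · rw [ho.neg_one_pow] at hlt ⊢
    change N (-1) < m at hlt
    refine key (-1) (by norm_num) ?_
    rw [hsum, show N 1 = m by omega, show N ⟨0, 1⟩ = m by omega, show N ⟨0, -1⟩ = m by omega, hI]
    have : (m : GaussianInt) = N (-1) + 1 := by exact_mod_cast (show m = N (-1) + 1 by omega)
    rw [this]; ring

/-- For an odd prime `l ∤ α` the value `χ(±l)` of the quartic character attached to `α + x i` is a
function `θ` of `x` modulo `l`, vanishing where `l` divides `α² + x²` and with known power sums. -/
theorem exists_quarticSymbol (l : ℕ) [Fact l.Prime] (hl : l ≠ 2) {α : ℤ} (hα : ¬ (l : ℤ) ∣ α) :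
    ∃ θ : ZMod l → GaussianInt,
      (∀ y, θ y = 0 ↔ (α : ZMod l) ^ 2 + y ^ 2 = 0) ∧
      (∀ y, θ y ≠ 0 → θ y ^ 4 = 1) ∧
      (∀ k, 0 < k → ∑ y, θ y ^ k =
        if 4 ∣ k then (tauPrimePow l 1 : GaussianInt) else -((-1) ^ normOneQuarter l) ^ k) ∧
      ∀ (p : ℕ) [Fact p.Prime] (χ : MulChar (ZMod p) GaussianInt) (x : ℤ), p ≠ l →
        (p : ℤ) = α ^ 2 + x ^ 2 → orderOf χ = 4 → jacobiSum χ (χ ^ 2) = -χ (-1) * ⟨α, x⟩ →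
        χ (primeStar l) = θ x := by
  have hlp : l.Prime := Fact.out
  have hodd := hlp.eq_two_or_odd.resolve_left hl
  have hl2 : 2 < l := lt_of_le_of_ne hlp.two_le hl.symm
  set K := AlgebraicClosure (ZMod l)
  have : CharP K l := charP_of_injective_algebraMap (algebraMap (ZMod l) K).injective l
  have h2 : (2 : K) ≠ 0 := Ring.two_ne_zero (by rwa [ringChar.eq K l])
  obtain ⟨i, hi⟩ := IsAlgClosed.exists_pow_nat_eq (-1 : K) (n := 2) (by norm_num)
  set f : GaussianInt →+* K := Zsqrtd.lift ⟨i, by rw [← pow_two, hi]; simp⟩ with hf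
  have hfi : f ⟨0, 1⟩ = i := by simp [hf]
  set j : K := if l % 4 = 1 then i else -i with hjdef
  have hj : j ^ 2 = -1 := by rw [hjdef]; split_ifs <;> simp [hi]
  set φ := ZMod.castHom (dvd_refl l) K with hφ
  have hφl : ∀ y : ZMod l, φ y ^ l = φ y := fun y => by rw [← map_pow, ZMod.pow_card]
  set a : ZMod l := (α : ZMod l) with ha
  have ha0 : a ≠ 0 := by rwa [ha, Ne, ZMod.intCast_zmod_eq_zero_iff_dvd]
  have haK : φ a ≠ 0 := (map_ne_zero φ).2 ha0
  have hprod : ∀ y, (φ a + φ y * j) * (φ a - φ y * j) = φ (a ^ 2 + y ^ 2) := fun y => by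
    simp only [map_add, map_pow]
    linear_combination (-φ y ^ 2) * hj
  set m := normOneQuarter l with hm
  have hm0 : 0 < m := normOneQuarter_pos hl2 hodd
  have hex : ∀ y : ZMod l, ∃ u : GaussianInt, (u = 0 ↔ a ^ 2 + y ^ 2 = 0) ∧ (u ≠ 0 → u ^ 4 = 1) ∧
      (u ≠ 0 → f u * (φ a - φ y * j) ^ m = (φ a + φ y * j) ^ m) := by
    intro y
    by_cases h0 : a ^ 2 + y ^ 2 = 0
    · exact ⟨0, by simp [h0], by simp, by simp⟩
    have hne : φ (a ^ 2 + y ^ 2) ≠ 0 := (map_ne_zero φ).2 h0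
    rw [← hprod] at hne
    obtain ⟨hA, hB⟩ := mul_ne_zero_iff.1 hne
    set A := φ a + φ y * j with hAdef
    set B := φ a - φ y * j with hBdef
    have hA4 := add_mul_pow_four_mul_quarter hl hj (hφl a) (hφl y) hA
    have hB4 := add_mul_pow_four_mul_quarter (y := -φ y) hl hj (hφl a)
      (by rw [← map_neg, hφl]) (by rwa [neg_mul, ← sub_eq_add_neg])
    rw [neg_mul, ← sub_eq_add_neg, sub_neg_eq_add, ← hAdef, ← hBdef, mul_comm B A, ← hA4] at hB4
    have hz : (A ^ m / B ^ m) ^ 4 = 1 := by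
      rw [div_pow, ← pow_mul, ← pow_mul, mul_comm m 4, hB4, div_self (pow_ne_zero _ hA)]
    have hroot : ∃ u : GaussianInt, u ^ 4 = 1 ∧ f u = A ^ m / B ^ m := by
      generalize A ^ m / B ^ m = z at hz
      have : (z - 1) * ((z + 1) * ((z - i) * (z + i))) = 0 := by
        linear_combination hz - (z ^ 2 - 1) * hi
      rcases mul_eq_zero.1 this with h | h
      · exact ⟨1, by decide, by rw [map_one]; linear_combination -h⟩
      rcases mul_eq_zero.1 h with h | h
      · exact ⟨-1, by decide, by rw [map_neg, map_one]; linear_combination -h⟩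
      rcases mul_eq_zero.1 h with h | h
      · exact ⟨⟨0, 1⟩, by decide, by rw [hfi]; linear_combination -h⟩
      · exact ⟨-⟨0, 1⟩, by decide, by rw [map_neg, hfi]; linear_combination -h⟩
    obtain ⟨u, hu, hfu⟩ := hroot
    refine ⟨u, ?_, fun _ => hu, fun _ => ?_⟩
    · simp only [h0, iff_false]
      rintro rfl
      simp at hu
    · rw [hfu, div_mul_cancel₀ _ (pow_ne_zero _ hB)]
  choose θ hθ0 hθ4 hθ using hex
  refine ⟨θ, hθ0, hθ4, fun k hk => ?_, ?_⟩
  · have hfiber : ∀ u : GaussianInt, u ≠ 0 → ∀ y ∈ Finset.univ.filter (fun y => θ y = u),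
        (φ a + φ y * j) ^ m = f u * (φ a - φ y * j) ^ m := by
      intro u hu y hy
      rw [← (Finset.mem_filter.1 hy).2] at hu ⊢
      exact (hθ y hu).symm
    refine sum_pow_of_card_fibers (tauPrimePow_add_one hl2 hodd) ?_ hθ4 (fun u hu => ?_) ?_ hk
    · rw [← card_sq_add_sq_ne_zero hl ha0]
      simp only [Ne, hθ0]
    · exact (card_symbol_fiber_le h2 hj haK hm0 (f u) _
        (hfiber u (by rintro rfl; simp at hu))).1
    · exact (card_symbol_fiber_le h2 hj haK hm0 (f ((-1) ^ m)) _
        (hfiber _ (pow_ne_zero _ (by decide)))).2 (by simp)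
  · intro p _ χ x hpl hp hχ hJ
    have hpp : p.Prime := Fact.out
    have hrec := quartic_reciprocity (K := K) hl hpl f hp hχ hJ (j := j) (by rw [hfi])
    have hx0 : a ^ 2 + (x : ZMod l) ^ 2 ≠ 0 := by
      have : a ^ 2 + (x : ZMod l) ^ 2 = ((p : ℕ) : ZMod l) := by
        rw [ha]; exact_mod_cast (congrArg (Int.cast : ℤ → ZMod l) hp).symm
      rw [this, Ne, ZMod.natCast_eq_zero_iff, Nat.prime_dvd_prime_iff_eq hlp hpp]
      exact hpl.symm
    have hθx : θ x ≠ 0 := fun h => hx0 ((hθ0 _).1 h)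
    have h1 := hθ x hθx
    have hφa : φ a = (α : K) := by rw [ha, map_intCast]
    have hφx : φ (x : ZMod l) = (x : K) := map_intCast _ _
    have hB : (α : K) - x * j ≠ 0 := by
      have h3 : φ (a ^ 2 + (x : ZMod l) ^ 2) ≠ 0 := (map_ne_zero φ).2 hx0
      rw [← hprod, hφa, hφx] at h3
      exact right_ne_zero_of_mul h3
    rw [hφa, hφx, ← hrec] at h1
    have h5 := mul_right_cancel₀ (pow_ne_zero _ hB) h1
    have hχ4 : χ (primeStar l) ^ 4 = 1 := by
      refine quartic_pow_four hχ fun h => ?_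
      rw [h, MulChar.map_zero, map_zero] at hrec
      have hA : (α : K) + x * j ≠ 0 := by
        have h3 : φ (a ^ 2 + (x : ZMod l) ^ 2) ≠ 0 := (map_ne_zero φ).2 hx0
        rw [← hprod, hφa, hφx] at h3
        exact left_ne_zero_of_mul h3
      exact pow_ne_zero _ hA (by rw [← hrec, zero_mul])
    -- The four units have distinct images in odd characteristic.
    set w := χ (primeStar l) * star (θ x) with hw
    have hs := GaussianInt.mul_star_of_pow_four_eq_one (hθ4 _ hθx)
    have hw4 : w ^ 4 = 1 := by
      rw [hw, mul_pow, hχ4, one_mul, ← star_pow, hθ4 _ hθx, star_one]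
    have hfw : f w = 1 := by rw [hw, map_mul, ← h5, ← map_mul, hs, map_one]
    have hw1 : w = 1 := by
      have h11 : (-1 : K) ≠ 1 := fun h => h2 (by linear_combination -h)
      rcases GaussianInt.eq_of_pow_four_eq_one hw4 with h | h | h | h
      · exact h
      · rw [h, map_neg, map_one] at hfw; exact absurd hfw h11
      · rw [h, hfi] at hfw; rw [hfw, one_pow] at hi; exact absurd hi.symm h11
      · rw [h, show (⟨0, -1⟩ : GaussianInt) = -⟨0, 1⟩ by decide, map_neg, hfi] at hfw
        rw [← neg_sq, hfw, one_pow] at hi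
        exact absurd hi.symm h11
    linear_combination θ x * hw1 - χ (primeStar l) * hs

/-! ### Primes `α² + x²` in residue classes of `x` -/

section HardyLittlewood

/-- The rate `√n / log n` at `n = N + 1`, since the conjecture counts the primes below `n` and
`primesSqAdd` those up to `N`. -/
noncomputable def hlRate (N : ℕ) : ℝ := Real.sqrt ((N + 1 : ℕ) : ℝ) / Real.log ((N + 1 : ℕ) : ℝ)

lemma tendsto_hlRate : Tendsto hlRate atTop atTop := by
  have h1 : Tendsto (fun x : ℝ => Real.sqrt x / Real.log x) atTop atTop := by
    have h := isLittleO_log_rpow_atTop (show (0 : ℝ) < 1 / 2 by norm_num)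
    have h2 := h.tendsto_div_nhds_zero
    have h3 : Tendsto (fun x : ℝ => Real.log x / x ^ (1 / 2 : ℝ)) atTop (𝓝[>] 0) := by
      rw [tendsto_nhdsWithin_iff]
      refine ⟨h2, ?_⟩
      filter_upwards [eventually_gt_atTop 1] with x hx
      exact div_pos (Real.log_pos hx) (Real.rpow_pos_of_pos (by linarith) _)
    refine h3.inv_tendsto_nhdsGT_zero.congr fun x => ?_
    rw [Pi.inv_apply, inv_div, Real.sqrt_eq_rpow]
  exact h1.comp (tendsto_natCast_atTop_atTop.comp (tendsto_add_atTop_nat 1))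

/-- The primes `α² + x²` with `x ≥ 0` in the class of `x₀` modulo `M`. -/
def classPrimes (α : ℤ) (M x₀ : ℕ) : Set ℕ :=
  {p : ℕ | p.Prime ∧ ∃ k : ℕ, (p : ℤ) = α ^ 2 + ((x₀ + M * k : ℕ) : ℤ) ^ 2}

lemma quadraticPrimes_eq_classPrimes (α : ℤ) (M x₀ : ℕ) :
    quadraticPrimes ((M : ℤ) ^ 2) (2 * M * x₀) (α ^ 2 + (x₀ : ℤ) ^ 2) = classPrimes α M x₀ := by
  ext p
  refine and_congr_right fun _ => exists_congr fun k => ?_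
  push_cast
  constructor <;> intro h <;> linear_combination h

lemma hlFiniteFactor_class {M : ℕ} (hM0 : 0 < M) (hM : Even M) (x₀ : ℕ) :
    hlFiniteFactor ((M : ℤ) ^ 2) (2 * M * x₀) = hlFiniteFactor ((M : ℤ) ^ 2) 0 := by
  obtain ⟨m, rfl⟩ := hM
  unfold hlFiniteFactor
  congr 2
  · have h1 : (2 : ℤ) ∣ ((m + m : ℕ) : ℤ) ^ 2 + 2 * (m + m : ℕ) * x₀ :=
      ⟨2 * m ^ 2 + 2 * m * x₀, by push_cast; ring⟩
    have h2 : (2 : ℤ) ∣ ((m + m : ℕ) : ℤ) ^ 2 + 0 := ⟨2 * m ^ 2, by push_cast; ring⟩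
    rw [show Int.gcd 2 _ = 2 by exact_mod_cast Int.gcd_eq_left (by norm_num) h1,
      show Int.gcd 2 _ = 2 by exact_mod_cast Int.gcd_eq_left (by norm_num) h2]
  · refine Finset.filter_congr fun p hp => ?_
    have hp' := Nat.mem_primeFactors.1 hp
    have hd : (p : ℤ) ∣ (m + m : ℕ) := by
      have := hp'.2.1
      rw [Int.natAbs_pow, Int.natAbs_natCast] at this
      exact_mod_cast hp'.1.dvd_of_dvd_pow this
    have : (p : ℤ) ∣ 2 * (m + m : ℕ) * x₀ := (hd.mul_left 2).mul_right _
    simp only [this, dvd_zero]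

/-- Under the Hardy-Littlewood Conjecture all admissible classes modulo `M` receive asymptotically
the same number of primes: the constant depends only on the leading coefficient `M²` and the
discriminant `-4 M² α²`. It is nonzero since the classes contain infinitely many primes. -/
theorem exists_tendsto_classPrimes (hHL : HardyLittlewoodConjecture) {α : ℤ} (hα : α ≠ 0) {M : ℕ}
    (hM0 : 0 < M) (hM : Even M) :
    ∃ C : ℝ, C ≠ 0 ∧ ∀ x₀ : ℕ, IsCoprime (α ^ 2 + (x₀ : ℤ) ^ 2) M →
      Tendsto (fun N => ({p | p ∈ classPrimes α M x₀ ∧ p < N + 1}.ncard : ℝ) / hlRate N)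
        atTop (𝓝 C) := by
  have hlim : ∀ x₀ : ℕ, IsCoprime (α ^ 2 + (x₀ : ℤ) ^ 2) M →
      ∃ L : ℝ, Tendsto (hlPartialProduct ((M : ℤ) ^ 2) 0 (α ^ 2)) atTop (𝓝 L) ∧
        hlFiniteFactor ((M : ℤ) ^ 2) 0 * L ≠ 0 ∧
        Tendsto (fun N => ({p | p ∈ classPrimes α M x₀ ∧ p < N + 1}.ncard : ℝ) / hlRate N)
          atTop (𝓝 (hlFiniteFactor ((M : ℤ) ^ 2) 0 * L)) := by
    intro x₀ hx₀
    have hMZ : (0 : ℤ) < M := by exact_mod_cast hM0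
    have hdisc : (2 * (M : ℤ) * x₀) ^ 2 - 4 * (M : ℤ) ^ 2 * (α ^ 2 + (x₀ : ℤ) ^ 2) =
        0 ^ 2 - 4 * (M : ℤ) ^ 2 * α ^ 2 := by ring
    have hgcd : Int.gcd ((M : ℤ) ^ 2) (Int.gcd (2 * M * x₀) (α ^ 2 + (x₀ : ℤ) ^ 2)) = 1 := by
      rw [← Int.isCoprime_iff_gcd_eq_one]
      have h1 : IsCoprime ((M : ℤ) ^ 2) (α ^ 2 + (x₀ : ℤ) ^ 2) := hx₀.symm.pow_left
      exact IsCoprime.of_isCoprime_of_dvd_right h1 (Int.gcd_dvd_right _ _)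
    have hpar : ¬ (Even ((M : ℤ) ^ 2 + 2 * M * x₀) ∧ Even (α ^ 2 + (x₀ : ℤ) ^ 2)) := by
      rintro ⟨_, h⟩
      obtain ⟨m, rfl⟩ := hM
      have h2 : (2 : ℤ) ∣ (m + m : ℕ) := ⟨m, by push_cast; ring⟩
      have := hx₀.isUnit_of_dvd' h.two_dvd h2
      rw [Int.isUnit_iff] at this
      omega
    have hsq : ¬ IsSquare ((2 * (M : ℤ) * x₀) ^ 2 - 4 * (M : ℤ) ^ 2 * (α ^ 2 + (x₀ : ℤ) ^ 2)) := by
      rw [hdisc]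
      intro h
      have := h.nonneg
      have : 0 < (M : ℤ) ^ 2 * α ^ 2 := by positivity
      linarith
    obtain ⟨L, hL, hequiv, hinf⟩ := hHL _ _ _ (by positivity) hgcd hpar hsq
    have hprod : hlPartialProduct ((M : ℤ) ^ 2) (2 * M * x₀) (α ^ 2 + (x₀ : ℤ) ^ 2) =
        hlPartialProduct ((M : ℤ) ^ 2) 0 (α ^ 2) := by
      funext N
      unfold hlPartialProduct
      rw [hdisc]
    rw [hprod] at hL
    rw [hlFiniteFactor_class hM0 hM] at hequiv
    rw [quadraticPrimes_eq_classPrimes] at hinf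
    set c := hlFiniteFactor ((M : ℤ) ^ 2) 0 * L
    have hcount : ∀ n, quadraticPrimeCount ((M : ℤ) ^ 2) (2 * M * x₀) (α ^ 2 + (x₀ : ℤ) ^ 2) n =
        {p | p ∈ classPrimes α M x₀ ∧ p < n}.ncard := fun n => by
      rw [quadraticPrimeCount, quadraticPrimes_eq_classPrimes]
    simp only [hcount] at hequiv
    have hc : c ≠ 0 := by
      intro hc
      simp only [hc, zero_mul] at hequiv
      have h0 := (isEquivalent_zero_iff_eventually_zero).1 hequiv
      obtain ⟨q, hq⟩ := hinf.nonempty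
      obtain ⟨n, hn, hn'⟩ := (h0.and (eventually_gt_atTop q)).exists
      have hfin : {p | p ∈ classPrimes α M x₀ ∧ p < n}.Finite :=
        (Set.finite_lt_nat n).subset fun p hp => hp.2
      have : {p | p ∈ classPrimes α M x₀ ∧ p < n}.ncard = 0 := Nat.cast_eq_zero.1 hn
      rw [Set.ncard_eq_zero hfin] at this
      exact (this ▸ (show q ∈ {p | p ∈ classPrimes α M x₀ ∧ p < n} from ⟨hq, hn'⟩) :
        q ∈ (∅ : Set ℕ))
    refine ⟨L, hL, hc, ?_⟩
    have hrate : ∀ᶠ N in atTop, hlRate N ≠ 0 := tendsto_hlRate.eventually_ne_atTop 0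
    have h1 := hequiv.comp_tendsto (tendsto_add_atTop_nat 1)
    have h2 := (isEquivalent_iff_tendsto_one (by
      filter_upwards [hrate] with N hN
      exact mul_ne_zero hc hN)).1 h1
    have h3 := h2.const_mul c
    rw [mul_one] at h3
    refine h3.congr' ?_
    filter_upwards [hrate] with N hN
    change c * (({p | p ∈ classPrimes α M x₀ ∧ p < N + 1}.ncard : ℝ) / (c * hlRate N)) = _
    field_simp
  by_cases hex : ∃ x₀ : ℕ, IsCoprime (α ^ 2 + (x₀ : ℤ) ^ 2) (M : ℤ)
  · obtain ⟨x₁, hx₁⟩ := hex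
    obtain ⟨L, hL, hne, _⟩ := hlim x₁ hx₁
    refine ⟨_, hne, fun x₀ hx₀ => ?_⟩
    obtain ⟨L', hL', _, h⟩ := hlim x₀ hx₀
    rwa [tendsto_nhds_unique hL hL']
  · exact ⟨1, one_ne_zero, fun x₀ hx₀ => absurd ⟨x₀, hx₀⟩ hex⟩

/-- The residue classes `x₀` modulo `M` for which `α² + x₀²` is coprime to `M`. -/
noncomputable def admissibleClasses (α : ℤ) (M : ℕ) : Finset ℕ :=
  open Classical in (Finset.range M).filter fun x => IsCoprime (α ^ 2 + (x : ℤ) ^ 2) M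

lemma finite_primesSqAdd (α : ℤ) (N : ℕ) : (primesSqAdd α N).Finite :=
  (Set.finite_le_nat N).subset fun _ hp => hp.2.1

/-- A property of the primes `p = α² + x²` that, up to finitely many exceptions, depends only on
`x` modulo `M`, holds for `#G * C * hlRate N` of them, `G` being the set of classes where it holds
and `C` the common constant of the admissible classes. -/
lemma tendsto_card_div_hlRate {α : ℤ} {M : ℕ} {C : ℝ}
    (hC : ∀ x₀ : ℕ, IsCoprime (α ^ 2 + (x₀ : ℤ) ^ 2) M →
      Tendsto (fun N => ({p | p ∈ classPrimes α M x₀ ∧ p < N + 1}.ncard : ℝ) / hlRate N)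
        atTop (𝓝 C))
    {G : Finset ℕ} (hG : G ⊆ admissibleClasses α M) {R : ℕ → Prop} {B : Set ℕ} (hB : B.Finite)
    (hR : ∀ p : ℕ, p.Prime → p ∉ B → ∀ x : ℕ, (p : ℤ) = α ^ 2 + (x : ℤ) ^ 2 → (R p ↔ x % M ∈ G)) :
    Tendsto (fun N => ({p | p ∈ primesSqAdd α N ∧ R p}.ncard : ℝ) / hlRate N) atTop
      (𝓝 (G.card * C)) := by
  classical
  have hGM : ∀ x ∈ G, x < M := fun x hx =>
    Finset.mem_range.1 (Finset.mem_filter.1 (hG hx)).1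
  set cl : ℕ → ℕ → Finset ℕ := fun N x₀ =>
    (Finset.range (N + 1)).filter (· ∈ classPrimes α M x₀) with hcl
  have hclcard : ∀ N x₀, (cl N x₀).card = {p | p ∈ classPrimes α M x₀ ∧ p < N + 1}.ncard := by
    intro N x₀
    rw [← Set.ncard_coe_finset]
    congr 1
    ext p
    simp [hcl, and_comm]
  have hdisj : ∀ N, (G : Set ℕ).PairwiseDisjoint (cl N) := by
    intro N x hx y hy hxy
    refine Finset.disjoint_left.2 fun p hpx hpy => hxy ?_
    obtain ⟨_, k, hk⟩ := (Finset.mem_filter.1 hpx).2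
    obtain ⟨_, k', hk'⟩ := (Finset.mem_filter.1 hpy).2
    have h2 : (x + M * k) ^ 2 = (y + M * k') ^ 2 := by
      rw [hk] at hk'
      exact_mod_cast add_left_cancel hk'
    have h3 := Nat.pow_left_injective (n := 2) (by norm_num) h2
    have h4 := congrArg (· % M) h3
    simpa [Nat.add_mul_mod_self_left, Nat.mod_eq_of_lt (hGM x hx), Nat.mod_eq_of_lt (hGM y hy)]
      using h4
  set U : ℕ → Finset ℕ := fun N => G.biUnion (cl N) with hU
  have hUcard : ∀ N, ((U N).card : ℝ) =
      ∑ x ∈ G, ({p | p ∈ classPrimes α M x ∧ p < N + 1}.ncard : ℝ) := by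
    intro N
    rw [hU, Finset.card_biUnion (hdisj N)]
    push_cast
    exact Finset.sum_congr rfl fun x _ => by rw [hclcard]
  have hlimU : Tendsto (fun N => ((U N).card : ℝ) / hlRate N) atTop (𝓝 (G.card * C)) := by
    have h := tendsto_finsetSum G fun x hx => hC x (Finset.mem_filter.1 (hG hx)).2
    rw [Finset.sum_const, nsmul_eq_mul] at h
    refine h.congr fun N => ?_
    rw [hUcard, Finset.sum_div]
  have hdiff1 : ∀ N, {p | p ∈ primesSqAdd α N ∧ R p} \ (U N : Set ℕ) ⊆ B := by
    rintro N p ⟨⟨⟨hp, hpN, x, hx⟩, hRp⟩, hpU⟩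
    by_contra hpB
    refine hpU ?_
    have hx' : (p : ℤ) = α ^ 2 + (x.natAbs : ℤ) ^ 2 := by rw [hx, Int.natAbs_sq]
    have hmem := (hR p hp hpB _ hx').1 hRp
    refine Finset.mem_coe.2 (Finset.mem_biUnion.2 ⟨_, hmem, Finset.mem_filter.2
      ⟨Finset.mem_range.2 (by omega), hp, x.natAbs / M, ?_⟩⟩)
    rw [Nat.mod_add_div, hx']
  have hdiff2 : ∀ N, (U N : Set ℕ) \ {p | p ∈ primesSqAdd α N ∧ R p} ⊆ B := by
    rintro N p ⟨hpU, hpS⟩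
    by_contra hpB
    obtain ⟨x, hxG, hpx⟩ := Finset.mem_biUnion.1 (Finset.mem_coe.1 hpU)
    obtain ⟨hpN, hp, k, hk⟩ := Finset.mem_filter.1 hpx
    refine hpS ⟨⟨hp, by have := Finset.mem_range.1 hpN; omega, _, hk⟩,
      (hR p hp hpB _ hk).2 ?_⟩
    rwa [Nat.add_mul_mod_self_left, Nat.mod_eq_of_lt (hGM x hxG)]
  have hbound : ∀ N, |({p | p ∈ primesSqAdd α N ∧ R p}.ncard : ℝ) - (U N).card| ≤ B.ncard := by
    intro N
    have hfin : {p | p ∈ primesSqAdd α N ∧ R p}.Finite :=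
      (finite_primesSqAdd α N).subset fun _ hp => hp.1
    have h1 := Set.ncard_le_ncard_sdiff_add_ncard {p | p ∈ primesSqAdd α N ∧ R p} (U N : Set ℕ)
      (Finset.finite_toSet _)
    have h2 := Set.ncard_le_ncard_sdiff_add_ncard (U N : Set ℕ) {p | p ∈ primesSqAdd α N ∧ R p} hfin
    have h3 := Set.ncard_le_ncard (hdiff1 N) hB
    have h4 := Set.ncard_le_ncard (hdiff2 N) hB
    rw [Set.ncard_coe_finset] at h1 h2
    rw [abs_le]
    constructor
    · have : (U N).card ≤ B.ncard + {p | p ∈ primesSqAdd α N ∧ R p}.ncard := by omega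
      have : ((U N).card : ℝ) ≤ B.ncard + {p | p ∈ primesSqAdd α N ∧ R p}.ncard := by
        exact_mod_cast this
      linarith
    · have : {p | p ∈ primesSqAdd α N ∧ R p}.ncard ≤ B.ncard + (U N).card := by omega
      have : ({p | p ∈ primesSqAdd α N ∧ R p}.ncard : ℝ) ≤ B.ncard + (U N).card := by
        exact_mod_cast this
      linarith
  have hzero : Tendsto (fun N => (({p | p ∈ primesSqAdd α N ∧ R p}.ncard : ℝ) - (U N).card) /
      hlRate N) atTop (𝓝 0) := by
    have hb : Tendsto (fun N => (B.ncard : ℝ) / hlRate N) atTop (𝓝 0) :=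
      tendsto_const_nhds.div_atTop tendsto_hlRate
    refine squeeze_zero_norm' ?_ hb
    filter_upwards [tendsto_hlRate.eventually_gt_atTop 0] with N hN
    rw [Real.norm_eq_abs, abs_div, abs_of_pos hN]
    exact div_le_div_of_nonneg_right (hbound N) hN.le
  have := hlimU.add hzero
  rw [add_zero] at this
  refine this.congr fun N => ?_
  rw [← add_div]
  congr 1
  ring

/-- Under the Hardy-Littlewood Conjecture a property of the primes `p = α² + x²` that depends only
on `x` modulo `M` has as density the proportion of admissible classes where it holds. -/
theorem tendsto_density (hHL : HardyLittlewoodConjecture) {α : ℤ} (hα : α ≠ 0) {M : ℕ}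
    (hM0 : 0 < M) (hM : Even M) (hA : (admissibleClasses α M).Nonempty)
    {G : Finset ℕ} (hG : G ⊆ admissibleClasses α M) {R : ℕ → Prop} {B : Set ℕ} (hB : B.Finite)
    (hR : ∀ p : ℕ, p.Prime → p ∉ B → ∀ x : ℕ, (p : ℤ) = α ^ 2 + (x : ℤ) ^ 2 → (R p ↔ x % M ∈ G)) :
    Tendsto (fun N => ({p | p ∈ primesSqAdd α N ∧ R p}.ncard : ℝ) / (primesSqAdd α N).ncard) atTop
      (𝓝 (G.card / (admissibleClasses α M).card)) := by
  obtain ⟨C, hC0, hC⟩ := exists_tendsto_classPrimes hHL hα hM0 hM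
  have h1 := tendsto_card_div_hlRate hC hG hB hR
  have h2 := tendsto_card_div_hlRate hC (Finset.Subset.refl _) (R := fun _ => True)
    (B := {p | p ∣ M}) ((Set.finite_le_nat M).subset fun p hp => Nat.le_of_dvd hM0 hp) (by
      intro p hp hpM x hx
      refine iff_of_true trivial (Finset.mem_filter.2
        ⟨Finset.mem_range.2 (Nat.mod_lt _ hM0), ?_⟩)
      have hcop : IsCoprime (p : ℤ) (M : ℤ) :=
        Nat.isCoprime_iff_coprime.2 ((Nat.Prime.coprime_iff_not_dvd hp).2 hpM)
      rw [hx] at hcop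
      have hdecomp : (x : ℤ) = ((x % M : ℕ) : ℤ) + M * ((x / M : ℕ) : ℤ) := by
        exact_mod_cast (Nat.mod_add_div x M).symm
      have : α ^ 2 + (x : ℤ) ^ 2 = α ^ 2 + ((x % M : ℕ) : ℤ) ^ 2 +
          M * (2 * ((x % M : ℕ) : ℤ) * ((x / M : ℕ) : ℤ) + M * ((x / M : ℕ) : ℤ) ^ 2) := by
        rw [hdecomp]; ring
      rw [this] at hcop
      exact IsCoprime.of_add_mul_left_left hcop)
  simp only [and_true, Set.ofPred_mem_eq] at h2
  have hcard : ((admissibleClasses α M).card : ℝ) ≠ 0 := by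
    exact_mod_cast (Finset.card_pos.2 hA).ne'
  have h3 := h1.div h2 (mul_ne_zero hcard hC0)
  rw [mul_div_mul_right _ _ hC0] at h3
  refine h3.congr' ?_
  filter_upwards [tendsto_hlRate.eventually_ne_atTop 0] with N hN
  rw [Pi.div_apply, div_div_div_cancel_right₀ hN]

end HardyLittlewood

/-! ### Sums of products of periodic functions -/

section Periodic

variable {R : Type*} [CommRing R]

lemma sum_range_mul_of_periodic {a b : ℕ} (ha : 0 < a) (hb : 0 < b) (hab : a.Coprime b)
    {f g : ℕ → R} (hf : ∀ x, f (x % a) = f x) (hg : ∀ x, g (x % b) = g x) :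
    ∑ x ∈ Finset.range (a * b), f x * g x =
      (∑ x ∈ Finset.range a, f x) * ∑ x ∈ Finset.range b, g x := by
  rw [Finset.sum_mul_sum, ← Finset.sum_product']
  refine Finset.sum_nbij (fun x => (x % a, x % b)) ?_ ?_ ?_ ?_
  · intro x _
    simp [Nat.mod_lt _ ha, Nat.mod_lt _ hb]
  · intro x hx y hy hxy
    simp only [Finset.coe_range, Set.mem_Iio, Prod.mk.injEq] at hx hy hxy
    have := (Nat.modEq_and_modEq_iff_modEq_mul hab).1 hxy
    exact Nat.ModEq.eq_of_lt_of_lt this hx hy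
  · rintro ⟨u, v⟩ huv
    simp only [Finset.coe_product, Finset.coe_range, Set.mem_prod, Set.mem_Iio] at huv
    obtain ⟨k, hk1, hk2⟩ := Nat.chineseRemainder hab u v
    refine ⟨k % (a * b), by simpa using Nat.mod_lt _ (Nat.mul_pos ha hb), ?_⟩
    simp only [Nat.mod_mul_right_mod, Nat.mod_mul_left_mod, Prod.mk.injEq]
    exact ⟨Nat.mod_eq_of_modEq hk1 huv.1, Nat.mod_eq_of_modEq hk2 huv.2⟩
  · intro x _
    simp only [hf, hg]

lemma mod_periodic_of_dvd {β : Type*} {f : ℕ → β} {m M : ℕ} (hmM : m ∣ M)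
    (hf : ∀ x, f (x % m) = f x) (x : ℕ) : f (x % M) = f x := by
  rw [← hf (x % M), Nat.mod_mod_of_dvd _ hmM, hf]

/-- The Chinese remainder theorem for sums over a full period. -/
lemma sum_range_prod_of_periodic (T : Finset ℕ) (hpos : ∀ m ∈ T, 0 < m)
    (hcop : ∀ m ∈ T, ∀ n ∈ T, m ≠ n → m.Coprime n) {f : ℕ → ℕ → R}
    (hf : ∀ m ∈ T, ∀ x, f m (x % m) = f m x) :
    ∑ x ∈ Finset.range (∏ m ∈ T, m), ∏ m ∈ T, f m x = ∏ m ∈ T, ∑ x ∈ Finset.range m, f m x := by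
  classical
  induction T using Finset.induction_on with
  | empty => simp
  | insert n T hn ih =>
    simp only [Finset.prod_insert hn]
    have hpos' : ∀ m ∈ T, 0 < m := fun m hm => hpos m (Finset.mem_insert_of_mem hm)
    have hf' : ∀ m ∈ T, ∀ x, f m (x % m) = f m x := fun m hm => hf m (Finset.mem_insert_of_mem hm)
    rw [sum_range_mul_of_periodic (hpos n (Finset.mem_insert_self _ _)) (Finset.prod_pos hpos')
      (Nat.Coprime.prod_right fun m hm => hcop _ (Finset.mem_insert_self _ _) _
        (Finset.mem_insert_of_mem hm) fun h => hn (h ▸ hm))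
      (hf n (Finset.mem_insert_self _ _))
      (fun x => Finset.prod_congr rfl fun m hm =>
        mod_periodic_of_dvd (Finset.dvd_prod_of_mem _ hm) (hf' m hm) x),
      ih hpos' (fun m hm k hk => hcop m (Finset.mem_insert_of_mem hm) k
        (Finset.mem_insert_of_mem hk)) hf']

lemma sum_range_natCast_zmod (n : ℕ) [NeZero n] (f : ZMod n → R) :
    ∑ x ∈ Finset.range n, f (x : ZMod n) = ∑ y, f y :=
  Finset.sum_nbij' (fun x => (x : ZMod n)) ZMod.val (by simp) (by simp [ZMod.val_lt])
    (fun x hx => ZMod.val_cast_of_lt (Finset.mem_range.1 hx)) (fun y _ => ZMod.natCast_zmod_val y)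
    (fun _ _ => rfl)

end Periodic

/-! ### Counting values of a product of local symbols -/

/-- A local symbol at `m`: a function modulo `m` with values in the fourth roots of unity where
`α² + x²` is coprime to `m`, and zero elsewhere. -/
structure IsLocalSymbol (α : ℤ) (m : ℕ) (h : ℕ → GaussianInt) : Prop where
  periodic : ∀ x, h (x % m) = h x
  ne_zero_iff : ∀ x : ℕ, h x ≠ 0 ↔ IsCoprime (α ^ 2 + (x : ℤ) ^ 2) m
  pow_four : ∀ x, h x ≠ 0 → h x ^ 4 = 1

lemma IsLocalSymbol.pow {α : ℤ} {m : ℕ} {h : ℕ → GaussianInt} (hh : IsLocalSymbol α m h) {e : ℕ}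
    (he : e ≠ 0) : IsLocalSymbol α m fun x => h x ^ e where
  periodic x := by simp only [hh.periodic]
  ne_zero_iff x := by rw [← hh.ne_zero_iff, pow_ne_zero_iff he]
  pow_four x hx := by
    rw [← pow_mul, mul_comm, pow_mul, hh.pow_four x ((pow_ne_zero_iff he).1 hx), one_pow]

lemma IsLocalSymbol.prod {α : ℤ} {T : Finset ℕ} {h : ℕ → ℕ → GaussianInt}
    (hh : ∀ m ∈ T, IsLocalSymbol α m (h m)) :
    IsLocalSymbol α (∏ m ∈ T, m) fun x => ∏ m ∈ T, h m x where
  periodic x := Finset.prod_congr rfl fun m hm =>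
    mod_periodic_of_dvd (Finset.dvd_prod_of_mem _ hm) (hh m hm).periodic x
  ne_zero_iff x := by
    push_cast
    rw [Finset.prod_ne_zero_iff, IsCoprime.prod_right_iff]
    exact forall₂_congr fun m hm => (hh m hm).ne_zero_iff x
  pow_four x hx := by
    rw [← Finset.prod_pow]
    exact Finset.prod_eq_one fun m hm =>
      (hh m hm).pow_four x (Finset.prod_ne_zero_iff.1 hx m hm)

section CountValues

variable {α : ℤ} {M : ℕ} {Θ : ℕ → GaussianInt}

lemma IsLocalSymbol.card_admissibleClasses (hΘ : IsLocalSymbol α M Θ) :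
    ((admissibleClasses α M).card : GaussianInt) = ∑ x ∈ Finset.range M, Θ x ^ 4 := by
  classical
  rw [admissibleClasses, Finset.card_eq_sum_ones, Nat.cast_sum, Finset.sum_filter]
  refine Finset.sum_congr rfl fun x _ => ?_
  by_cases h : Θ x = 0
  · rw [if_neg (fun hc => (hΘ.ne_zero_iff x).2 hc h), h]; simp
  · rw [if_pos ((hΘ.ne_zero_iff x).1 h), hΘ.pow_four x h]; simp

/-- Orthogonality on the group of fourth roots of unity. -/
lemma IsLocalSymbol.four_mul_card_eq (hΘ : IsLocalSymbol α M Θ) {s : GaussianInt}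
    (hs : s = 1 ∨ s = -1) :
    4 * (((Finset.range M).filter fun x => Θ x = s).card : GaussianInt) =
      ∑ x ∈ Finset.range M, (Θ x ^ 4 + s * Θ x + Θ x ^ 2 + s * Θ x ^ 3) := by
  classical
  rw [Finset.card_eq_sum_ones, Nat.cast_sum, Finset.sum_filter, Finset.mul_sum]
  refine Finset.sum_congr rfl fun x _ => ?_
  by_cases h : Θ x = 0
  · rw [h, if_neg (by rcases hs with rfl | rfl <;> decide)]; simp
  · rcases GaussianInt.eq_of_pow_four_eq_one (hΘ.pow_four x h) with h | h | h | h <;>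
      rcases hs with rfl | rfl <;> rw [h] <;> decide

lemma IsLocalSymbol.filter_subset (hΘ : IsLocalSymbol α M Θ) {s : GaussianInt} (hs : s ≠ 0) :
    (Finset.range M).filter (fun x => Θ x = s) ⊆ admissibleClasses α M := by
  classical
  intro x hx
  obtain ⟨h1, h2⟩ := Finset.mem_filter.1 hx
  exact Finset.mem_filter.2 ⟨h1, (hΘ.ne_zero_iff x).1 (h2 ▸ hs)⟩

end CountValues

/-- The quartic symbol at an odd prime as a local symbol. -/
lemma exists_isLocalSymbol {l : ℕ} (hl : l.Prime) (hl2 : l ≠ 2) {α : ℤ} (hα : ¬ (l : ℤ) ∣ α) :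
    ∃ θ : ℕ → GaussianInt, IsLocalSymbol α l θ ∧
      (∀ k, 0 < k → ∑ x ∈ Finset.range l, θ x ^ k =
        ((if 4 ∣ k then (tauPrimePow l 1 : ℤ) else -((-1) ^ normOneQuarter l) ^ k : ℤ) :
          GaussianInt)) ∧
      ∀ (p : ℕ) [Fact p.Prime] (χ : MulChar (ZMod p) GaussianInt) (x : ℕ), p ≠ l →
        (p : ℤ) = α ^ 2 + (x : ℤ) ^ 2 → orderOf χ = 4 →
        jacobiSum χ (χ ^ 2) = -χ (-1) * ⟨α, x⟩ → χ (primeStar l) = θ x := by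
  have : Fact l.Prime := ⟨hl⟩
  obtain ⟨θ, h0, h4, hsum, hχ⟩ := exists_quarticSymbol l hl2 hα
  refine ⟨fun x => θ x, ⟨fun x => by simp, fun x => ?_, fun x => h4 x⟩, fun k hk => ?_, ?_⟩
  · rw [Ne, h0, isCoprime_comm, (Nat.prime_iff_prime_int.1 hl).irreducible.coprime_iff_not_dvd,
      ← ZMod.intCast_zmod_eq_zero_iff_dvd]
    push_cast; rfl
  · rw [sum_range_natCast_zmod l fun y => θ y ^ k, hsum k hk]
    split_ifs <;> push_cast <;> rfl
  · intro p _ χ x hpl hp hord hJ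
    have := hχ p χ x hpl hp hord hJ
    rwa [Int.cast_natCast] at this

/-! ### Products over the prime divisors of `D` -/

lemma prod_union_exponent {R : Type*} [CommMonoid R] {P Q L : Finset ℕ} (hPQ : Disjoint P Q)
    (hPL : Disjoint P L) (hQL : Disjoint Q L) (F : ℕ → ℕ → R) :
    ∏ l ∈ P ∪ Q ∪ L, F l (if l ∈ P then 1 else if l ∈ Q then 2 else 3) =
      (∏ l ∈ P, F l 1) * (∏ l ∈ Q, F l 2) * ∏ l ∈ L, F l 3 := by
  rw [Finset.prod_union (Finset.disjoint_union_left.2 ⟨hPL, hQL⟩), Finset.prod_union hPQ]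
  congr 1
  · congr 1
    · exact Finset.prod_congr rfl fun l hl => by rw [if_pos hl]
    · refine Finset.prod_congr rfl fun l hl => ?_
      rw [if_neg fun h => Finset.disjoint_left.1 hPQ h hl, if_pos hl]
  · refine Finset.prod_congr rfl fun l hl => ?_
    rw [if_neg fun h => Finset.disjoint_left.1 hPL h hl,
      if_neg fun h => Finset.disjoint_left.1 hQL h hl]

lemma tau_prod {S : Finset ℕ} (hS : ∀ l ∈ S, l.Prime) :
    tau (∏ l ∈ S, l) = ∏ l ∈ S, tauPrimePow l 1 := by
  have hsupp : (∏ l ∈ S, l).factorization.support = S := by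
    rw [Nat.support_factorization, Nat.primeFactors_prod hS]
  rw [tau, Finsupp.prod, hsupp]
  refine Finset.prod_congr rfl fun l hl => ?_
  congr 1
  rw [Nat.factorization_prod fun q hq => (hS q hq).ne_zero, Finset.sum_apply',
    Finset.sum_eq_single_of_mem l hl]
  · exact (hS l hl).factorization_self
  · intro q hq hne
    rw [(hS q hq).factorization, Finsupp.single_eq_of_ne hne.symm]

/-- The sign `-(-1) ^ normOneQuarter l` is `-1` precisely for `l ≡ ±1 (mod 8)`. -/
lemma prod_neg_one_pow_normOneQuarter {S : Finset ℕ} (hS : ∀ l ∈ S, l % 2 = 1) :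
    ∏ l ∈ S, (-(-1) ^ normOneQuarter l : ℤ) = (-1) ^ (countMod8 S 1 + countMod8 S 7) := by
  have h : ∀ l ∈ S, (-(-1) ^ normOneQuarter l : ℤ) =
      (if l ≡ 1 [MOD 8] then -1 else 1) * (if l ≡ 7 [MOD 8] then -1 else 1) := by
    intro l hl
    have h2 := hS l hl
    unfold Nat.ModEq normOneQuarter
    have h8 : l % 8 = 1 ∨ l % 8 = 3 ∨ l % 8 = 5 ∨ l % 8 = 7 := by omega
    rcases h8 with h8 | h8 | h8 | h8
    · rw [if_pos (by omega), (show Even ((l - 1) / 4) by rw [Nat.even_iff]; omega).neg_one_pow]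
      simp [h8]
    · rw [if_neg (by omega), (show Odd ((l + 1) / 4) by rw [Nat.odd_iff]; omega).neg_one_pow]
      simp [h8]
    · rw [if_pos (by omega), (show Odd ((l - 1) / 4) by rw [Nat.odd_iff]; omega).neg_one_pow]
      simp [h8]
    · rw [if_neg (by omega), (show Even ((l + 1) / 4) by rw [Nat.even_iff]; omega).neg_one_pow]
      simp [h8]
  rw [Finset.prod_congr rfl h, Finset.prod_mul_distrib, ← Finset.prod_filter, ← Finset.prod_filter,
    Finset.prod_const, Finset.prod_const, ← pow_add]
  rfl

lemma primeStar_modEq_one {l : ℕ} (hl : l % 2 = 1) : primeStar l ≡ 1 [ZMOD 4] := by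
  unfold primeStar Int.ModEq
  split_ifs <;> omega

lemma natAbs_primeStar (l : ℕ) : (primeStar l).natAbs = l := by
  unfold primeStar
  split_ifs <;> simp

/-- An integer congruent to `±1` modulo `4` whose prime factorization is known up to sign equals
`±1` times the product of the primes normalised to be congruent to `1` modulo `4`. -/
lemma eq_prod_primeStar {n : ℤ} {S : Finset ℕ} {e : ℕ → ℕ} (hS : ∀ l ∈ S, l % 2 = 1)
    (hn : n.natAbs = ∏ l ∈ S, l ^ e l) :
    (n ≡ 1 [ZMOD 4] → n = ∏ l ∈ S, primeStar l ^ e l) ∧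
      (n ≡ 3 [ZMOD 4] → n = -∏ l ∈ S, primeStar l ^ e l) := by
  set O := ∏ l ∈ S, primeStar l ^ e l with hO
  have hO1 : O % 4 = 1 := by
    have : O ≡ 1 [ZMOD 4] := by
      rw [hO]
      refine Finset.prod_induction _ (fun z => z ≡ 1 [ZMOD 4]) (fun a b ha hb => ?_) rfl
        fun l hl => ?_
      · simpa using ha.mul hb
      · simpa using (primeStar_modEq_one (hS l hl)).pow (e l)
    exact this
  have habs : n.natAbs = O.natAbs := by
    rw [hn, hO, ← Int.natAbsHom_apply, map_prod]
    exact Finset.prod_congr rfl fun l _ => by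
      rw [Int.natAbsHom_apply, Int.natAbs_pow, natAbs_primeStar]
  unfold Int.ModEq
  rcases Int.natAbs_eq_natAbs_iff.1 habs with h | h <;> constructor <;> intro h' <;> omega

/-! ### The trace densities -/

/-- If the quartic character at `D` is a local symbol `Θ` of `x`, the trace densities are the
proportions of admissible classes with `Θ = 1` and with `Θ = -1`. -/
theorem hasTraceDensity_of_isLocalSymbol (hHL : HardyLittlewoodConjecture) {D α : ℤ} (hD0 : D ≠ 0)
    (hα : α ≡ 1 [ZMOD 4]) {M : ℕ} (hM0 : 0 < M) (hM : Even M)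
    (hA : (admissibleClasses α M).Nonempty) {Θ : ℕ → GaussianInt} (hΘ : IsLocalSymbol α M Θ)
    (hval : ∀ (p : ℕ) [Fact p.Prime] (χ : MulChar (ZMod p) GaussianInt) (x : ℕ), ¬ (p : ℤ) ∣ D →
      Even x → (p : ℤ) = α ^ 2 + (x : ℤ) ^ 2 → orderOf χ = 4 →
      jacobiSum χ (χ ^ 2) = -χ (-1) * ⟨α, x⟩ → χ D = Θ x) :
    HasTraceDensity D α (((Finset.range M).filter fun x => Θ x = 1).card /
        (admissibleClasses α M).card) ∧
      HasTraceDensity D (-α) (((Finset.range M).filter fun x => Θ x = -1).card /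
        (admissibleClasses α M).card) := by
  have hα4 := hα.eq
  have hαodd : Odd α := by rw [Int.odd_iff]; omega
  have hα0 : α ≠ 0 := by rintro rfl; simp at hαodd
  have hΔ : (curveE D).Δ = -(2 ^ 6 * D ^ 3) := by
    simp [curveE, WeierstrassCurve.Δ, WeierstrassCurve.b₂, WeierstrassCurve.b₄,
      WeierstrassCurve.b₆, WeierstrassCurve.b₈]
    ring
  have hΔ0 : (curveE D).Δ ≠ 0 := by
    rw [hΔ]
    exact neg_ne_zero.2 (mul_ne_zero (by norm_num) (pow_ne_zero _ hD0))
  have hB : {p : ℕ | (p : ℤ) ∣ (curveE D).Δ}.Finite := by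
    refine (Set.finite_le_nat (curveE D).Δ.natAbs).subset fun p hp => ?_
    exact Nat.le_of_dvd (Int.natAbs_pos.2 hΔ0) (Int.natCast_dvd.1 hp)
  have key : ∀ p : ℕ, p.Prime → ¬ (p : ℤ) ∣ (curveE D).Δ → ∀ x : ℕ, (p : ℤ) = α ^ 2 + (x : ℤ) ^ 2 →
      (frobeniusTrace D p = 2 * α ↔ Θ x = 1) ∧ (frobeniusTrace D p = 2 * -α ↔ Θ x = -1) := by
    intro p hp hpΔ x hx
    have : Fact p.Prime := ⟨hp⟩
    have hpD : ¬ (p : ℤ) ∣ D := fun h => hpΔ (hΔ ▸ ((h.pow (by norm_num)).mul_left _).neg_right)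
    have hp2 : p ≠ 2 := by
      rintro rfl
      exact hpΔ (hΔ ▸ ((dvd_pow_self _ (by norm_num)).mul_right _).neg_right)
    have hpodd := hp.eq_two_or_odd.resolve_left hp2
    have hxe : Even x := by
      by_contra hxo
      have h1 : Even (α ^ 2 + (x : ℤ) ^ 2) :=
        hαodd.pow.add_odd (by exact_mod_cast (Nat.not_even_iff_odd.1 hxo).pow)
      rw [← hx, Int.even_iff] at h1
      omega
    have hxe' : Even (x : ℤ) := by exact_mod_cast hxe
    obtain ⟨χ, hχ, hJ⟩ := exists_quarticChar hx hα hxe'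
    rw [← hval p χ x hpD hxe hx hχ hJ]
    exact frobeniusTrace_eq_iff hχ hpD hJ hαodd hxe'
  have hmem : ∀ (s : GaussianInt) (x : ℕ),
      x % M ∈ (Finset.range M).filter (fun x => Θ x = s) ↔ Θ x = s := by
    intro s x
    rw [Finset.mem_filter, Finset.mem_range, hΘ.periodic]
    exact and_iff_right (Nat.mod_lt _ hM0)
  have h1 := tendsto_density hHL hα0 hM0 hM hA (hΘ.filter_subset (s := 1) one_ne_zero)
    (R := fun p => ¬ (p : ℤ) ∣ (curveE D).Δ ∧ frobeniusTrace D p = 2 * α) hB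
    fun p hp hpB x hx => by rw [hmem, ← (key p hp hpB x hx).1]; exact and_iff_right hpB
  have h2 := tendsto_density hHL hα0 hM0 hM hA (hΘ.filter_subset (s := -1) (by decide))
    (R := fun p => ¬ (p : ℤ) ∣ (curveE D).Δ ∧ frobeniusTrace D p = 2 * -α) hB
    fun p hp hpB x hx => by rw [hmem, ← (key p hp hpB x hx).2]; exact and_iff_right hpB
  have hneg : ∀ N, primesSqAdd α N = primesSqAdd (-α) N := fun N => by
    unfold primesSqAdd; rw [neg_sq]
  simp only [hneg] at h2
  exact ⟨h1, h2⟩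

lemma isCoprime_sq_add_sq_four_iff {α : ℤ} (hα : Odd α) (x : ℕ) :
    IsCoprime (α ^ 2 + (x : ℤ) ^ 2) (4 : ℕ) ↔ Even x := by
  rw [show ((4 : ℕ) : ℤ) = 2 ^ 2 by norm_num, IsCoprime.pow_right_iff (by norm_num), isCoprime_comm,
    Int.prime_two.irreducible.coprime_iff_not_dvd, ← even_iff_two_dvd]
  have h1 : Odd (α ^ 2) := hα.pow
  rw [Int.even_add, ← Int.not_odd_iff_even (n := α ^ 2)]
  simp only [h1, not_true, false_iff, not_not]
  rw [Int.even_pow' (by norm_num), Int.even_coe_nat]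

/-- The densities for `D = ± 4 ∏ l ^ e`, given a local symbol `h₄` at `4` which accounts for the
factor that `4` and the sign contribute to the quartic character; its odd power sums are `2 c`. -/
theorem hasTraceDensity_of_symbol_four (hHL : HardyLittlewoodConjecture) {D α : ℤ}
    {P Q L : Finset ℕ} (hP : ∀ l ∈ P, l.Prime ∧ l ≠ 2) (hQ : ∀ l ∈ Q, l.Prime ∧ l ≠ 2)
    (hL : ∀ l ∈ L, l.Prime ∧ l ≠ 2) (hPQ : Disjoint P Q) (hPL : Disjoint P L) (hQL : Disjoint Q L)
    (hD0 : D ≠ 0) (hα : α ≡ 1 [ZMOD 4])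
    (hSD : ∀ l ∈ P ∪ Q ∪ L, (l : ℤ) ∣ D) (hSα : ∀ l ∈ P ∪ Q ∪ L, ¬ (l : ℤ) ∣ α)
    {h₄ : ℕ → GaussianInt} (hh₄ : IsLocalSymbol α 4 h₄) {c : ℤ}
    (hsum₄ : ∀ k, 0 < k → ∑ x ∈ Finset.range 4, h₄ x ^ k =
      ((if Even k then 2 else 2 * c : ℤ) : GaussianInt))
    (hχ₄ : ∀ (p : ℕ) [Fact p.Prime] (χ : MulChar (ZMod p) GaussianInt) (x : ℕ), Even x →
      (p : ℤ) = α ^ 2 + (x : ℤ) ^ 2 → orderOf χ = 4 →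
      χ D = h₄ x * ∏ l ∈ P ∪ Q ∪ L,
        χ (primeStar l) ^ (if l ∈ P then 1 else if l ∈ Q then 2 else 3)) :
    HasTraceDensity D α
        (1 / 4 * (1 + (-1 : ℝ) ^ (P.card + L.card) / (tau ((∏ l ∈ P, l) * ∏ l ∈ L, l) : ℝ)
          + c * (2 * (-1 : ℝ) ^ (countMod8 P 1 + countMod8 P 7 + Q.card
              + countMod8 L 1 + countMod8 L 7) /
            (tau ((∏ l ∈ P, l) * (∏ l ∈ Q, l) * ∏ l ∈ L, l) : ℝ)))) ∧
      HasTraceDensity D (-α)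
        (1 / 4 * (1 + (-1 : ℝ) ^ (P.card + L.card) / (tau ((∏ l ∈ P, l) * ∏ l ∈ L, l) : ℝ)
          - c * (2 * (-1 : ℝ) ^ (countMod8 P 1 + countMod8 P 7 + Q.card
              + countMod8 L 1 + countMod8 L 7) /
            (tau ((∏ l ∈ P, l) * (∏ l ∈ Q, l) * ∏ l ∈ L, l) : ℝ)))) := by
  classical
  set S := P ∪ Q ∪ L with hSdef
  set e : ℕ → ℕ := fun l => if l ∈ P then 1 else if l ∈ Q then 2 else 3 with he
  have hS : ∀ l ∈ S, l.Prime ∧ l ≠ 2 := by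
    intro l hl
    rcases Finset.mem_union.1 hl with hl | hl
    · exact (Finset.mem_union.1 hl).elim (hP l) (hQ l)
    · exact hL l hl
  have hodd : ∀ l ∈ S, l % 2 = 1 := fun l hl =>
    (hS l hl).1.eq_two_or_odd.resolve_left (hS l hl).2
  have he0 : ∀ l, 0 < e l := fun l => by simp only [he]; split_ifs <;> norm_num
  have hex : ∀ l, ∃ θ : ℕ → GaussianInt, l ∈ S → IsLocalSymbol α l θ ∧
      (∀ k, 0 < k → ∑ x ∈ Finset.range l, θ x ^ k =
        ((if 4 ∣ k then (tauPrimePow l 1 : ℤ) else -((-1) ^ normOneQuarter l) ^ k : ℤ) :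
          GaussianInt)) ∧
      ∀ (p : ℕ) [Fact p.Prime] (χ : MulChar (ZMod p) GaussianInt) (x : ℕ), p ≠ l →
        (p : ℤ) = α ^ 2 + (x : ℤ) ^ 2 → orderOf χ = 4 →
        jacobiSum χ (χ ^ 2) = -χ (-1) * ⟨α, x⟩ → χ (primeStar l) = θ x := by
    intro l
    by_cases hl : l ∈ S
    · obtain ⟨θ, h⟩ := exists_isLocalSymbol (hS l hl).1 (hS l hl).2 (hSα l hl)
      exact ⟨θ, fun _ => h⟩
    · exact ⟨0, fun h => absurd h hl⟩
  choose θ hθ using hex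
  -- The local symbols at `4` and at the odd primes, indexed by their moduli.
  set h : ℕ → ℕ → GaussianInt := fun m x => if m = 4 then h₄ x else θ m x ^ e m with hh
  have h4S : 4 ∉ S := fun h => by have := hodd 4 h; omega
  have hne4 : ∀ l ∈ S, l ≠ 4 := fun l hl h => h4S (h ▸ hl)
  set T := insert 4 S with hT
  have hloc : ∀ m ∈ T, IsLocalSymbol α m (h m) := by
    intro m hm
    rcases Finset.mem_insert.1 hm with rfl | hm
    · simpa [hh] using hh₄
    · have := (hθ m hm).1.pow (he0 m).ne'
      simpa [hh, hne4 m hm] using this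
  have hpos : ∀ m ∈ T, 0 < m := by
    intro m hm
    rcases Finset.mem_insert.1 hm with rfl | hm
    · norm_num
    · exact (hS m hm).1.pos
  have hcop : ∀ m ∈ T, ∀ n ∈ T, m ≠ n → m.Coprime n := by
    have h4cop : ∀ l ∈ S, Nat.Coprime 4 l := fun l hl =>
      Nat.Coprime.pow_left 2 (Nat.coprime_two_left.2 (Nat.odd_iff.2 (hodd l hl)))
    intro m hm n hn hmn
    rcases Finset.mem_insert.1 hm with rfl | hm <;> rcases Finset.mem_insert.1 hn with rfl | hn
    · exact absurd rfl hmn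
    · exact h4cop n hn
    · exact (h4cop m hm).symm
    · exact (Nat.coprime_primes (hS m hm).1 (hS n hn).1).2 hmn
  set M := ∏ m ∈ T, m with hM
  have hM0 : 0 < M := Finset.prod_pos hpos
  have hMeven : Even M :=
    even_iff_two_dvd.2 ((show 2 ∣ 4 by norm_num).trans
      (Finset.dvd_prod_of_mem _ (Finset.mem_insert_self 4 S)))
  set Θ : ℕ → GaussianInt := fun x => ∏ m ∈ T, h m x with hΘ
  have hΘloc : IsLocalSymbol α M Θ := IsLocalSymbol.prod hloc
  have hΘeq : ∀ x, Θ x = h₄ x * ∏ l ∈ S, θ l x ^ e l := by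
    intro x
    simp only [hΘ, hT, Finset.prod_insert h4S]
    congr 1
    exact Finset.prod_congr rfl fun l hl => by simp [hh, hne4 l hl]
  -- The power sums of the local symbol at an odd prime with multiplicity `e`.
  set F : ℕ → ℕ → ℕ → ℤ := fun k l e =>
    if 4 ∣ e * k then (tauPrimePow l 1 : ℤ) else -((-1) ^ normOneQuarter l) ^ (e * k) with hF
  have hpow : ∀ k, 0 < k → ∑ x ∈ Finset.range M, Θ x ^ k =
      (((if Even k then 2 else 2 * c) *
        ((∏ l ∈ P, F k l 1) * (∏ l ∈ Q, F k l 2) * ∏ l ∈ L, F k l 3) : ℤ) : GaussianInt) := by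
    intro k hk
    have h1 := sum_range_prod_of_periodic T hpos hcop (f := fun m x => h m x ^ k)
      fun m hm x => by simp only [(hloc m hm).periodic]
    simp only [hΘ, ← Finset.prod_pow]
    rw [h1, hT, Finset.prod_insert h4S, ← prod_union_exponent hPQ hPL hQL (F k), Int.cast_mul,
      ← hsum₄ k hk, Int.cast_prod]
    congr 1
    refine Finset.prod_congr rfl fun l hl => ?_
    rw [← (hθ l hl).2.1 _ (Nat.mul_pos (he0 l) hk)]
    refine Finset.sum_congr rfl fun x _ => ?_
    simp only [hh, if_neg (hne4 l hl), ← pow_mul]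
  have hs2 : ∀ l, ((-1 : ℤ) ^ normOneQuarter l) ^ 2 = 1 := fun l => by
    rw [← pow_mul, mul_comm, pow_mul]; norm_num
  set t : Finset ℕ → ℤ := fun X => ∏ l ∈ X, (tauPrimePow l 1 : ℤ) with ht
  set u : Finset ℕ → ℤ := fun X => ∏ l ∈ X, (-(-1) ^ normOneQuarter l : ℤ) with hu
  have hsq : ∀ X : Finset ℕ, ∀ n, ∏ l ∈ X, (-((-1) ^ normOneQuarter l) ^ (2 * n) : ℤ) =
      (-1) ^ X.card := fun X n => by
    rw [Finset.prod_congr rfl (g := fun _ => (-1 : ℤ)) fun l _ => by rw [pow_mul, hs2, one_pow],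
      Finset.prod_const]
  have hcu : ∀ X : Finset ℕ, ∀ n, ∏ l ∈ X, (-((-1) ^ normOneQuarter l) ^ (2 * n + 1) : ℤ) =
      u X := fun X n => by
    simp only [hu]
    exact Finset.prod_congr rfl fun l _ => by rw [pow_succ, pow_mul, hs2, one_pow, one_mul]
  have h4sum : ∑ x ∈ Finset.range M, Θ x ^ 4 = ((2 * (t P * t Q * t L) : ℤ) : GaussianInt) := by
    rw [hpow 4 (by norm_num)]
    simp [hF, ht, show Even 4 by decide]
  have h2sum : ∑ x ∈ Finset.range M, Θ x ^ 2 =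
      ((2 * ((-1) ^ P.card * t Q * (-1) ^ L.card) : ℤ) : GaussianInt) := by
    rw [hpow 2 (by norm_num), if_pos (by decide)]
    have h6 := hsq L 3
    have h2 := hsq P 1
    norm_num at h6 h2
    simp only [hF, ht]
    norm_num [h2, h6]
  have h1sum : ∑ x ∈ Finset.range M, Θ x ^ 1 =
      ((2 * c * (u P * (-1) ^ Q.card * u L) : ℤ) : GaussianInt) := by
    rw [hpow 1 (by norm_num), if_neg (by decide)]
    have h3 := hcu L 1
    have h2 := hsq Q 1
    have h1 := hcu P 0
    norm_num at h1 h3 h2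
    simp only [hF]
    norm_num [h2, h1, h3]
  have h3sum : ∑ x ∈ Finset.range M, Θ x ^ 3 =
      ((2 * c * (u P * (-1) ^ Q.card * u L) : ℤ) : GaussianInt) := by
    rw [hpow 3 (by norm_num), if_neg (by decide)]
    have h3 := hcu L 4
    have h2 := hsq Q 3
    have h1 := hcu P 1
    norm_num at h1 h3 h2
    simp only [hF]
    norm_num [h2, h1, h3]
  have hcast : Function.Injective (Int.cast : ℤ → GaussianInt) := Int.cast_injective
  have hAcard : ((admissibleClasses α M).card : ℤ) = 2 * (t P * t Q * t L) := by
    apply hcast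
    rw [← h4sum, ← hΘloc.card_admissibleClasses, Int.cast_natCast]
  have hG : ∀ s : ℤ, s = 1 ∨ s = -1 →
      4 * (((Finset.range M).filter fun x => Θ x = s).card : ℤ) = 2 * (t P * t Q * t L) +
        2 * ((-1) ^ P.card * t Q * (-1) ^ L.card) +
        s * (4 * c * (u P * (-1) ^ Q.card * u L)) := by
    intro s hs
    apply hcast
    have h1 := hΘloc.four_mul_card_eq (s := (s : GaussianInt))
      (by rcases hs with rfl | rfl <;> simp)
    rw [Finset.sum_add_distrib, Finset.sum_add_distrib, Finset.sum_add_distrib, ← Finset.mul_sum,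
      ← Finset.mul_sum, h4sum, h2sum, h3sum] at h1
    simp only [pow_one] at h1sum
    rw [h1sum] at h1
    rw [Int.cast_mul, Int.cast_natCast, Int.cast_ofNat, h1]
    push_cast
    ring
  have htpos : ∀ X ⊆ S, 0 < t X := by
    intro X hX
    refine Finset.prod_pos fun l hl => ?_
    have h1 := hodd l (hX hl)
    have h2 := (hS l (hX hl)).1.two_le
    unfold tauPrimePow
    split_ifs <;> simp <;> omega
  have htP := htpos P (Finset.subset_union_left.trans Finset.subset_union_left)
  have htQ := htpos Q (Finset.subset_union_right.trans Finset.subset_union_left)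
  have htL := htpos L Finset.subset_union_right
  have hA : (admissibleClasses α M).Nonempty := by
    rw [← Finset.card_pos]
    have : 0 < 2 * (t P * t Q * t L) := by positivity
    omega
  have hval : ∀ (p : ℕ) [Fact p.Prime] (χ : MulChar (ZMod p) GaussianInt) (x : ℕ),
      ¬ (p : ℤ) ∣ D → Even x → (p : ℤ) = α ^ 2 + (x : ℤ) ^ 2 → orderOf χ = 4 →
      jacobiSum χ (χ ^ 2) = -χ (-1) * ⟨α, x⟩ → χ D = Θ x := by
    intro p _ χ x hpD hx hp hχ hJ
    rw [hχ₄ p χ x hx hp hχ, hΘeq]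
    congr 1
    refine Finset.prod_congr rfl fun l hl => ?_
    rw [(hθ l hl).2.2 p χ x (fun h => hpD (h ▸ hSD l hl)) hp hχ hJ]
  have hmain := hasTraceDensity_of_isLocalSymbol hHL hD0 hα hM0 hMeven hA hΘloc hval
  have htau1 : (tau ((∏ l ∈ P, l) * ∏ l ∈ L, l) : ℝ) = t P * t L := by
    rw [← Finset.prod_union hPL, tau_prod fun l hl =>
      ((Finset.mem_union.1 hl).elim (hP l) (hL l)).1, Finset.prod_union hPL]
    simp [ht]
  have htau2 : (tau ((∏ l ∈ P, l) * (∏ l ∈ Q, l) * ∏ l ∈ L, l) : ℝ) = t P * t Q * t L := by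
    rw [← Finset.prod_union hPQ, ← Finset.prod_union (Finset.disjoint_union_left.2 ⟨hPL, hQL⟩),
      tau_prod fun l hl => (hS l hl).1, Finset.prod_union (Finset.disjoint_union_left.2 ⟨hPL, hQL⟩),
      Finset.prod_union hPQ]
    simp [ht]
  have huP : u P = (-1) ^ (countMod8 P 1 + countMod8 P 7) :=
    prod_neg_one_pow_normOneQuarter fun l hl =>
      hodd l (Finset.subset_union_left (Finset.subset_union_left hl))
  have huL : u L = (-1) ^ (countMod8 L 1 + countMod8 L 7) :=
    prod_neg_one_pow_normOneQuarter fun l hl => hodd l (Finset.subset_union_right hl)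
  have hAR : ((admissibleClasses α M).card : ℝ) = 2 * (t P * t Q * t L) := by
    exact_mod_cast congrArg (Int.cast : ℤ → ℝ) hAcard
  have htP' : (t P : ℝ) ≠ 0 := by exact_mod_cast htP.ne'
  have htQ' : (t Q : ℝ) ≠ 0 := by exact_mod_cast htQ.ne'
  have htL' : (t L : ℝ) ≠ 0 := by exact_mod_cast htL.ne'
  have hsign : (-1 : ℝ) ^ (countMod8 P 1 + countMod8 P 7 + Q.card + countMod8 L 1 + countMod8 L 7) =
      u P * (-1) ^ Q.card * u L := by
    rw [huP, huL]; push_cast; ring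
  have hGR : ∀ s : ℤ, s = 1 ∨ s = -1 →
      (((Finset.range M).filter fun x => Θ x = s).card : ℝ) / (admissibleClasses α M).card =
      1 / 4 * (1 + (-1 : ℝ) ^ (P.card + L.card) / (t P * t L) +
        s * (c * (2 * (u P * (-1) ^ Q.card * u L) / (t P * t Q * t L)))) := by
    intro s hs
    have h1 : (4 : ℝ) * (((Finset.range M).filter fun x => Θ x = s).card : ℝ) =
        2 * (t P * t Q * t L) + 2 * ((-1) ^ P.card * t Q * (-1) ^ L.card) +
        s * (4 * c * (u P * (-1) ^ Q.card * u L)) := by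
      exact_mod_cast congrArg (Int.cast : ℤ → ℝ) (hG s hs)
    have h2 : (((Finset.range M).filter fun x => Θ x = s).card : ℝ) = (2 * (t P * t Q * t L) +
        2 * ((-1) ^ P.card * t Q * (-1) ^ L.card) +
        s * (4 * c * (u P * (-1) ^ Q.card * u L))) / 4 := by linarith
    rw [hAR, h2, pow_add]
    field_simp
    ring
  have hG1 := hGR 1 (Or.inl rfl)
  have hG2 := hGR (-1) (Or.inr rfl)
  simp only [Int.cast_one, one_mul, Int.cast_neg, neg_mul, ← sub_eq_add_neg] at hG1 hG2
  rw [htau1, htau2, hsign, ← hG1, ← hG2]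
  exact hmain

/-- The symbol at `4` for `D / 4 ≡ 3 (mod 4)`, where `χ(-4) = 1`. -/
lemma isLocalSymbol_even {α : ℤ} (hα : Odd α) :
    IsLocalSymbol α 4 fun x => if Even x then 1 else 0 where
  periodic x := by
    have : Even (x % 4) ↔ Even x := by rw [Nat.even_iff, Nat.even_iff]; omega
    simp only [this]
  ne_zero_iff x := by rw [isCoprime_sq_add_sq_four_iff hα]; simp
  pow_four x hx := by
    split_ifs at hx ⊢ with h
    · simp
    · exact absurd rfl hx

/-- The symbol `(-1) ^ (x / 2)` at `4` for `D / 4 ≡ 1 (mod 4)`, where `χ(4) = χ(-1)`. -/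
lemma isLocalSymbol_half {α : ℤ} (hα : Odd α) :
    IsLocalSymbol α 4 fun x => if Even x then (if x % 4 = 0 then 1 else -1) else 0 where
  periodic x := by
    have : Even (x % 4) ↔ Even x := by rw [Nat.even_iff, Nat.even_iff]; omega
    simp only [this, Nat.mod_mod]
  ne_zero_iff x := by
    rw [isCoprime_sq_add_sq_four_iff hα]
    split_ifs with h1 h2 <;> simp [h1]
  pow_four x hx := by
    split_ifs at hx ⊢ with h
    · simp
    · norm_num
    · exact absurd rfl hx

/-- For `p = α² + x²` with `x` even, `χ(-1) = (-1) ^ (x / 2)`. -/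
lemma quartic_neg_one_eq_of_sq_add_sq {p : ℕ} [Fact p.Prime] {χ : MulChar (ZMod p) GaussianInt}
    (hχ : orderOf χ = 4) {α : ℤ} (hα : Odd α) {x : ℕ} (hx : Even x)
    (hp : (p : ℤ) = α ^ 2 + (x : ℤ) ^ 2) : χ (-1) = if x % 4 = 0 then 1 else -1 := by
  rw [quartic_neg_one_eq hχ]
  have hiff : p % 8 = 1 ↔ x % 4 = 0 := by
    have h1 : α ^ 2 % 8 = 1 := by
      obtain ⟨z, rfl⟩ := hα
      obtain ⟨u, hu⟩ := Int.even_mul_succ_self z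
      rw [show (2 * z + 1) ^ 2 = 8 * u + 1 by linear_combination 4 * hu]
      omega
    generalize α ^ 2 = z at h1 hp
    obtain ⟨y, rfl⟩ := hx
    rcases Nat.even_or_odd' y with ⟨k, rfl | rfl⟩
    · have : (p : ℤ) = z + 16 * (k : ℤ) ^ 2 := by rw [hp]; push_cast; ring
      generalize (k : ℤ) ^ 2 = w at this
      omega
    · have : (p : ℤ) = z + 16 * ((k : ℤ) ^ 2 + k) + 4 := by rw [hp]; push_cast; ring
      generalize (k : ℤ) ^ 2 + k = w at this
      omega
  simp only [hiff]

theorem mainTheorem6 (hHL : HardyLittlewoodConjecture)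
    (D α : ℤ) (ε : ℤˣ) (σ : ℕ) (P Q L : Finset ℕ)
    (hP : ∀ l ∈ P, l.Prime ∧ l ≠ 2) (hQ : ∀ l ∈ Q, l.Prime ∧ l ≠ 2)
    (hL : ∀ l ∈ L, l.Prime ∧ l ≠ 2)
    (hPQ : Disjoint P Q) (hPL : Disjoint P L) (hQL : Disjoint Q L)
    (hD : D = (ε : ℤ) * 2 ^ σ * (∏ l ∈ P, (l : ℤ)) * (∏ l ∈ Q, (l : ℤ)) ^ 2 *
      (∏ l ∈ L, (l : ℤ)) ^ 3)
    (h4 : 4 ∣ D ∧ ¬ 8 ∣ D)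
    (hα : α ≡ 1 [ZMOD 4]) (hDα : Int.gcd D α = 1) :
    (D / 4 ≡ 3 [ZMOD 4] →
      HasTraceDensity D α
        (1 / 4 * (1 + (-1 : ℝ) ^ (P.card + L.card) / (tau ((∏ l ∈ P, l) * ∏ l ∈ L, l) : ℝ)
          + 2 * (-1 : ℝ) ^ (countMod8 P 1 + countMod8 P 7 + Q.card
              + countMod8 L 1 + countMod8 L 7) /
            (tau ((∏ l ∈ P, l) * (∏ l ∈ Q, l) * ∏ l ∈ L, l) : ℝ))) ∧
      HasTraceDensity D (-α)
        (1 / 4 * (1 + (-1 : ℝ) ^ (P.card + L.card) / (tau ((∏ l ∈ P, l) * ∏ l ∈ L, l) : ℝ)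
          - 2 * (-1 : ℝ) ^ (countMod8 P 1 + countMod8 P 7 + Q.card
              + countMod8 L 1 + countMod8 L 7) /
            (tau ((∏ l ∈ P, l) * (∏ l ∈ Q, l) * ∏ l ∈ L, l) : ℝ)))) ∧
    (D / 4 ≡ 1 [ZMOD 4] →
      HasTraceDensity D α
        (1 / 4 * (1 + (-1 : ℝ) ^ (P.card + L.card) /
          (tau ((∏ l ∈ P, l) * ∏ l ∈ L, l) : ℝ))) ∧
      HasTraceDensity D (-α)
        (1 / 4 * (1 + (-1 : ℝ) ^ (P.card + L.card) /
          (tau ((∏ l ∈ P, l) * ∏ l ∈ L, l) : ℝ)))) := by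
  have hD0 : D ≠ 0 := fun h => h4.2 (h ▸ dvd_zero 8)
  have hα4 := hα.eq
  have hαodd : Odd α := by rw [Int.odd_iff]; omega
  set S := P ∪ Q ∪ L with hSdef
  set e : ℕ → ℕ := fun l => if l ∈ P then 1 else if l ∈ Q then 2 else 3 with he
  have hS : ∀ l ∈ S, l.Prime ∧ l ≠ 2 := by
    intro l hl
    rcases Finset.mem_union.1 hl with hl | hl
    · exact (Finset.mem_union.1 hl).elim (hP l) (hQ l)
    · exact hL l hl
  have hodd : ∀ l ∈ S, l % 2 = 1 := fun l hl =>
    (hS l hl).1.eq_two_or_odd.resolve_left (hS l hl).2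
  have hO : (∏ l ∈ P, (l : ℤ)) * (∏ l ∈ Q, (l : ℤ)) ^ 2 * (∏ l ∈ L, (l : ℤ)) ^ 3 =
      ∏ l ∈ S, (l : ℤ) ^ e l := by
    rw [← Finset.prod_pow, ← Finset.prod_pow]
    have := prod_union_exponent hPQ hPL hQL fun l e => (l : ℤ) ^ e
    simp only [pow_one] at this
    exact this.symm
  set O := ∏ l ∈ S, (l : ℤ) ^ e l with hOdef
  have hDO : D = (ε : ℤ) * 2 ^ σ * O := by rw [hD, ← hO]; ring
  have hOodd : Odd O := by
    rw [hOdef]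
    refine Finset.prod_induction _ Odd (fun a b => Odd.mul) odd_one fun l hl => ?_
    exact Odd.pow (by exact_mod_cast Nat.odd_iff.2 (hodd l hl))
  have hεO : Odd ((ε : ℤ) * O) := by
    rcases Int.units_eq_one_or ε with rfl | rfl
    · simpa using hOodd
    · simpa using hOodd
  have hσ : σ = 2 := by
    have h2 : (ε : ℤ) * 2 ^ σ * O = 2 ^ σ * (ε * O) := by ring
    rw [hDO, h2] at h4
    rw [Int.odd_iff] at hεO
    have hle : σ < 3 := by
      by_contra hge
      exact h4.2 ((pow_dvd_pow (2 : ℤ) (not_lt.1 hge)).mul_right _)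
    interval_cases σ
    · have := h4.1; omega
    · have := h4.1; omega
    · rfl
  rw [hσ] at hDO
  have hdiv : D / 4 = ε * O := by
    rw [hDO, show (ε : ℤ) * 2 ^ 2 * O = ε * O * 4 by ring, Int.mul_ediv_cancel _ (by norm_num)]
  have hD4 : D = 4 * (D / 4) := by rw [hdiv, hDO]; ring
  have habs : (D / 4).natAbs = ∏ l ∈ S, l ^ e l := by
    rw [hdiv, Int.natAbs_mul, Int.units_natAbs, one_mul, hOdef]
    rw [show (∏ l ∈ S, (l : ℤ) ^ e l) = ((∏ l ∈ S, l ^ e l : ℕ) : ℤ) by push_cast; rfl,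
      Int.natAbs_natCast]
  have hSD : ∀ l ∈ S, (l : ℤ) ∣ D := by
    intro l hl
    have h1 : (l : ℤ) ∣ (l : ℤ) ^ e l :=
      dvd_pow_self _ (by simp only [he]; split_ifs <;> norm_num)
    rw [hDO]
    exact (h1.trans (Finset.dvd_prod_of_mem (fun l : ℕ => (l : ℤ) ^ e l) hl)).mul_left _
  have hSα : ∀ l ∈ S, ¬ (l : ℤ) ∣ α := by
    intro l hl h
    have h1 := Int.dvd_coe_gcd (hSD l hl) h
    rw [hDα] at h1
    exact (hS l hl).1.one_lt.ne' (by exact_mod_cast Int.eq_one_of_dvd_one (by positivity) h1)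
  have hchar : ∀ (p : ℕ) [Fact p.Prime] (χ : MulChar (ZMod p) GaussianInt),
      χ ((∏ l ∈ S, primeStar l ^ e l : ℤ) : ZMod p) = ∏ l ∈ S, χ (primeStar l) ^ e l := by
    intro p _ χ
    push_cast
    rw [map_prod]
    simp only [map_pow]
  obtain ⟨hone, hthree⟩ := eq_prod_primeStar hodd habs
  constructor
  · intro h
    have hD' := hthree h
    have := hasTraceDensity_of_symbol_four hHL hP hQ hL hPQ hPL hQL hD0 hα hSD hSα
      (isLocalSymbol_even hαodd) (c := 1) (fun k hk => by
        simp only [Finset.sum_range_succ, Finset.sum_range_zero]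
        simp [hk.ne', show ¬ Even 3 by decide]
        norm_num) (by
      intro p _ χ x hx _ hχ
      -- The factors `χ(4)` and `χ(-1)` cancel.
      rw [hD4, hD', mul_neg, ← neg_mul, Int.cast_mul, map_mul, hchar, if_pos hx]
      congr 1
      push_cast
      rw [show (-4 : ZMod p) = -1 * 4 by ring, map_mul, quartic_four hχ, MulChar.neg_one_mul_self])
    simpa only [Int.cast_one, one_mul] using this
  · intro h
    have hD' := hone h
    have := hasTraceDensity_of_symbol_four hHL hP hQ hL hPQ hPL hQL hD0 hα hSD hSα
      (isLocalSymbol_half hαodd) (c := 0) (fun k hk => by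
        simp only [Finset.sum_range_succ, Finset.sum_range_zero]
        rcases Nat.even_or_odd k with hk' | hk'
        · simp [hk.ne', show ¬ Even 3 by decide, hk', hk'.neg_one_pow]
          norm_num
        · simp [hk.ne', show ¬ Even 3 by decide, Nat.not_even_iff_odd.2 hk',
            hk'.neg_one_pow]) (by
      intro p _ χ x hx hp hχ
      rw [hD4, hD', Int.cast_mul, map_mul, hchar, if_pos hx,
        ← quartic_neg_one_eq_of_sq_add_sq hχ hαodd hx hp, ← quartic_four hχ]
      push_cast
      rfl)
    simpa only [Int.cast_zero, zero_mul, add_zero, sub_zero] using this
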